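/- There are absolute constants $C>0$ and $c\in\mathbb N$ such that the following holds. Let $G=(V,E,w)$ be a finite connected undirected graph on $n\ge 1$ vertices with nonnegative real edge weights, let $0<\varepsilon<1$, and let $k\ge 1$ be an integer. Write $d_F(u,v)$ for the weighted shortest-path distance in a graph $F$ ($d_F(u,v)=\infty$ if $u$ and $v$ are not connected in $F$). For a subgraph $F$ of $G$, write $w(F)$ for the total weight of its edges, and let $w(\mathrm{MST}(G))$ be the weight of a minimum spanning tree of $G$. Then $G$ has a subgraph $H=(V,E')$ with the following properties. 1. (Stretch.) For all $u,v\in V$, $$d_G(u,v)\le d_H(u,v)\le (1+\varepsilon)\,d_G(u,v)+\left(\frac{Ck}{\varepsilon}\right)^{k} W(u,v),$$ where $W(u,v)$ is the weight of the heaviest edge on a shortest $u$–$v$ path in $G$ (with $W(u,u)=0$); if there are several shortest paths, this holds for every choice of the path. 2. (Size.) $|E'|\le C\,k\,n^{1+3/k}$. 3. (Lightness.) $\dfrac{w(H)}{w(\mathrm{MST}(G))}\le C\,(\log n)^{c}\cdot\dfrac{n^{1/k}}{\varepsilon}$, where the ratio $0/0$ is read as $0$ (so that if $w(\mathrm{MST}(G))=0$,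 the claim is that $w(H)=0$). -/

import Mathlib

open scoped NNReal ENNReal

namespace LightSpanner

variable {V : Type*}

/-- The total weight of the edges traversed by a walk. -/
def walkWeight {G : SimpleGraph V} (w : Sym2 V → ℝ≥0) {u v : V} (p : G.Walk u v) : ℝ≥0 :=
  (p.edges.map w).sum

/-- The weight of the heaviest edge of a walk (`0` for the walk without edges). -/
def heaviestEdge {G : SimpleGraph V} (w : Sym2 V → ℝ≥0) {u v : V} (p : G.Walk u v) : ℝ≥0 :=
  (p.edges.map w).foldr max 0

/-- The weighted distance `d_G(u,v)`: the least weight of a `u`-`v` walk in `G`, and `⊤` if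
there is none. -/
noncomputable def wdist (G : SimpleGraph V) (w : Sym2 V → ℝ≥0) (u v : V) : ℝ≥0∞ :=
  ⨅ p : G.Walk u v, (walkWeight w p : ℝ≥0∞)

/-- `p` is a shortest `u`-`v` path of the weighted graph `(G, w)`. -/
def IsShortestPath {G : SimpleGraph V} (w : Sym2 V → ℝ≥0) {u v : V} (p : G.Walk u v) : Prop :=
  p.IsPath ∧ (walkWeight w p : ℝ≥0∞) = wdist G w u v

/-- `W` assigns to each pair `u, v` the weight of the heaviest edge on some shortest
`u`-`v` path. -/
def IsLocalMaxWeight (G : SimpleGraph V) (w : Sym2 V → ℝ≥0) (W : V → V → ℝ≥0) : Prop :=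
  ∀ u v : V, ∃ p : G.Walk u v, IsShortestPath w p ∧ W u v = heaviestEdge w p

/-- `H` is an `(α, β)`-spanner of `(G, w)`, where the additive error `β` may depend on the
pair of vertices. -/
def IsSpanner (G : SimpleGraph V) (w : Sym2 V → ℝ≥0) (H : SimpleGraph V)
    (α : ℝ≥0∞) (β : V → V → ℝ≥0∞) : Prop :=
  H ≤ G ∧ ∀ u v : V, wdist G w u v ≤ wdist H w u v ∧
    wdist H w u v ≤ α * wdist G w u v + β u v

open scoped Classical in
/-- The total edge weight of a graph. -/
noncomputable def totalWeight [Fintype V] (w : Sym2 V → ℝ≥0) (H : SimpleGraph V) : ℝ≥0 :=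
  ∑ e ∈ H.edgeFinset, w e

/-- The weight of a minimum spanning tree of `(G, w)`. -/
noncomputable def mstWeight [Fintype V] (G : SimpleGraph V) (w : Sym2 V → ℝ≥0) : ℝ≥0∞ :=
  ⨅ T : {T : SimpleGraph V // T ≤ G ∧ T.IsTree}, (totalWeight w T.1 : ℝ≥0∞)

/-- The lightness of a subgraph `H` of `(G, w)`: the ratio of the weight of `H` to the weight
of a minimum spanning tree of `G`. In `ℝ≥0∞` one has `0 / 0 = 0`, and `a / 0 = ⊤` if `a ≠ 0`. -/
noncomputable def lightness [Fintype V] (G : SimpleGraph V) (w : Sym2 V → ℝ≥0)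
    (H : SimpleGraph V) : ℝ≥0∞ :=
  (totalWeight w H : ℝ≥0∞) / mstWeight G w

end LightSpanner

/-! The spanner is the union, over the dyadic scales `r = 2 ^ j` of the positive edge weights, of
sets of edges `E r`, added to a minimum spanning tree `T` of weight `L`. Put `X = n ^ (1 / k)` and
`M = 200 k / ε`. If the allowed additive factor `(C k / ε) ^ k` is at least `n`, then `T` alone
will do, because `T` joins the ends of any path by edges that are not heavier than its heaviest
edge (`IsMST.gdist_le_card_mul_heaviestEdge`). Otherwise `M ^ k ≤ n`, hence `k ≤ M ≤ X` and
`k ≤ log n ≤ X ^ 2`, so that factors `k` and `log n` can be absorbed.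

At scale `r`, edges of weight at most `r / n` are free (`roundWeight`), as a path has fewer than
`n` of them. A hierarchy of centers is built with radii `ρ i = r M ^ (i + 1)`: level `0` is a
maximal `r`-separated set for the distance in `T`; a center is popular if it has more than `X`
centers of its level within `2 ρ i`; level `i + 1` is a maximal `4 ρ i`-separated set of popular
centers. Each level is smaller than the previous one by a factor `X`, so there are no popular
centers on level `k - 1`. Popular centers are connected to the next level, and unpopular ones to
all centers of their level within `ρ i`.

* Stretch (`stretch_of_levels`): walking along a path, two vertices clustered on level `h`, one of
  them around an unpopular center, at distance about `ρ h` are joined with an additive error of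
  at most `ρ h` times `ε / k`; where no such pair is available, a long piece of the path has lower
  level.
* Weight (`card_mul_le_of_separated`, `sum_scaleEdges_le`): the centers of level `i` are separated
  by about `ρ i / M`, so there are at most about `2 L M / ρ i` of them, each with at most `X`
  routes of weight `ρ i`. Only `O(log n)` scales matter (`sum_biUnion_scales_le`).
* Size (`card_scaleEdges_le`, `card_biUnion_scales_le`): routes follow parent edges of shortest
  path trees, where each class of vertices at rounded distance zero has a single parent edge per
  tree and is met by at most `X` trees of each level. A class is relevant only if it is left by a
  tree edge of weight between `r / n` and `4 r n`, and each tree edge is in that range for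
  `O(log n)` scales. -/

namespace LightSpanner

/-! ### Walks and weighted distances -/

section Distance

variable {V : Type*} {G G' : SimpleGraph V} {w w' : Sym2 V → ℝ≥0} {x y z : V}

@[simp] lemma walkWeight_nil : walkWeight w (SimpleGraph.Walk.nil : G.Walk x x) = 0 := by
  simp [walkWeight]

@[simp] lemma walkWeight_cons (h : G.Adj x y) (p : G.Walk y z) :
    walkWeight w (SimpleGraph.Walk.cons h p) = w s(x, y) + walkWeight w p := by
  simp [walkWeight]

lemma walkWeight_append (p : G.Walk x y) (q : G.Walk y z) :
    walkWeight w (p.append q) = walkWeight w p + walkWeight w q := by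
  simp [walkWeight]

lemma walkWeight_reverse (p : G.Walk x y) : walkWeight w p.reverse = walkWeight w p := by
  simp [walkWeight, List.sum_reverse]

lemma walkWeight_mapLe (h : G ≤ G') (p : G.Walk x y) :
    walkWeight w (p.mapLe h) = walkWeight w p := by
  simp only [walkWeight, SimpleGraph.Walk.edges_mapLe_eq_edges]

lemma walkWeight_mono (h : ∀ e, w e ≤ w' e) (p : G.Walk x y) :
    walkWeight w p ≤ walkWeight w' p :=
  List.sum_le_sum fun e _ => h e

open scoped Classical in
lemma walkWeight_bypass_le (p : G.Walk x y) : walkWeight w p.bypass ≤ walkWeight w p :=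
  ((p.edges_bypass_sublist_edges).map w).sum_le_sum (by simp)

lemma le_heaviestEdge {p : G.Walk x y} {e : Sym2 V} (he : e ∈ p.edges) :
    w e ≤ heaviestEdge w p := by
  unfold heaviestEdge
  generalize p.edges = l at he
  induction l with
  | nil => simp at he
  | cons a l ih =>
    rcases List.mem_cons.1 he with rfl | h
    · simp
    · simp [ih h]

/-- The weighted distance as a real number. It is meaningful only for vertices joined by a walk:
for other pairs it takes the junk value `0`. -/
noncomputable def gdist (G : SimpleGraph V) (w : Sym2 V → ℝ≥0) (x y : V) : ℝ :=
  (wdist G w x y).toReal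

lemma gdist_nonneg : 0 ≤ gdist G w x y := ENNReal.toReal_nonneg

lemma wdist_ne_top (hG : G.Connected) : wdist G w x y ≠ ⊤ := by
  obtain ⟨p⟩ := hG.preconnected x y
  exact ne_top_of_le_ne_top ENNReal.coe_ne_top (iInf_le _ p)

lemma ofReal_gdist (hG : G.Connected) : ENNReal.ofReal (gdist G w x y) = wdist G w x y :=
  ENNReal.ofReal_toReal (wdist_ne_top hG)

lemma gdist_le_walkWeight (p : G.Walk x y) : gdist G w x y ≤ walkWeight w p := by
  have h : wdist G w x y ≤ (walkWeight w p : ℝ≥0∞) := iInf_le _ p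
  simpa [gdist] using ENNReal.toReal_mono ENNReal.coe_ne_top h

/-- On a finite connected graph the distance is attained. -/
lemma exists_path_walkWeight_eq_gdist [Finite V] (hG : G.Connected) (w : Sym2 V → ℝ≥0) (x y : V) :
    ∃ p : G.Walk x y, p.IsPath ∧ (walkWeight w p : ℝ) = gdist G w x y := by
  classical
  have := Fintype.ofFinite V
  obtain ⟨p0⟩ := hG.preconnected x y
  have : Nonempty (G.Path x y) := ⟨p0.toPath⟩
  obtain ⟨p, hp⟩ := Finite.exists_min fun p : G.Path x y => walkWeight w p.1
  refine ⟨p.1, p.2, le_antisymm ?_ (gdist_le_walkWeight _)⟩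
  have h : (walkWeight w p.1 : ℝ≥0∞) ≤ wdist G w x y := by
    refine le_iInf fun q => ?_
    exact_mod_cast (hp q.toPath).trans (walkWeight_bypass_le q)
  simpa [gdist] using ENNReal.toReal_mono (wdist_ne_top hG) h

@[simp] lemma gdist_self : gdist G w x x = 0 :=
  le_antisymm (by simpa using gdist_le_walkWeight (w := w) (SimpleGraph.Walk.nil : G.Walk x x))
    gdist_nonneg

lemma gdist_comm : gdist G w x y = gdist G w y x := by
  have h : ∀ x y, wdist G w x y ≤ wdist G w y x := fun x y => le_iInf fun p => by
    rw [← walkWeight_reverse]; exact iInf_le _ p.reverse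
  rw [gdist, gdist, le_antisymm (h x y) (h y x)]

lemma gdist_triangle [Finite V] (hG : G.Connected) :
    gdist G w x z ≤ gdist G w x y + gdist G w y z := by
  obtain ⟨p, -, hp⟩ := exists_path_walkWeight_eq_gdist hG w x y
  obtain ⟨q, -, hq⟩ := exists_path_walkWeight_eq_gdist hG w y z
  rw [← hp, ← hq]
  exact_mod_cast (walkWeight_append (w := w) p q) ▸ gdist_le_walkWeight (p.append q)

lemma gdist_le_of_adj (h : G.Adj x y) : gdist G w x y ≤ w s(x, y) := by
  simpa using gdist_le_walkWeight (w := w) (SimpleGraph.Walk.cons h .nil)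

lemma gdist_anti [Finite V] (hG : G.Connected) (h : G ≤ G') :
    gdist G' w x y ≤ gdist G w x y := by
  obtain ⟨p, -, hp⟩ := exists_path_walkWeight_eq_gdist hG w x y
  rw [← hp, ← walkWeight_mapLe h]
  exact gdist_le_walkWeight _

lemma gdist_mono_weight [Finite V] (hG : G.Connected) (h : ∀ e, w e ≤ w' e) :
    gdist G w x y ≤ gdist G w' x y := by
  obtain ⟨p, -, hp⟩ := exists_path_walkWeight_eq_gdist hG w' x y
  rw [← hp]
  exact (gdist_le_walkWeight p).trans (by exact_mod_cast walkWeight_mono h p)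

open scoped Classical in
lemma walkWeight_le_totalWeight [Fintype V] {p : G.Walk x y} (hp : p.IsPath) :
    walkWeight w p ≤ totalWeight w G := by
  have h1 : walkWeight w p = ∑ e ∈ p.edges.toFinset, w e :=
    (List.sum_toFinset w hp.isTrail.edges_nodup).symm
  rw [h1, totalWeight]
  refine Finset.sum_le_sum_of_subset fun e he => ?_
  simpa using p.edges_subset_edgeSet (by simpa using he)

lemma gdist_le_totalWeight [Fintype V] (hG : G.Connected) (w : Sym2 V → ℝ≥0) (x y : V) :
    gdist G w x y ≤ totalWeight w G := by
  obtain ⟨p, hp, h⟩ := exists_path_walkWeight_eq_gdist hG w x y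
  rw [← h]
  exact_mod_cast walkWeight_le_totalWeight hp

/-- If two weights differ by at most `t` on each edge, then distances differ by at most `n t`, because
a shortest path has fewer than `n` edges. -/
lemma gdist_le_gdist_add [Fintype V] (hG : G.Connected) {t : ℝ} (ht : 0 ≤ t)
    (h : ∀ e ∈ G.edgeSet, (w e : ℝ) ≤ w' e + t) :
    gdist G w x y ≤ gdist G w' x y + Fintype.card V * t := by
  obtain ⟨p, hp, h'⟩ := exists_path_walkWeight_eq_gdist hG w' x y
  have key : ∀ {a b : V} (q : G.Walk a b),
      (walkWeight w q : ℝ) ≤ walkWeight w' q + q.length * t := by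
    intro a b q
    induction q with
    | nil => simp
    | cons hab q ih =>
      have := h _ ((SimpleGraph.mem_edgeSet _).2 hab)
      push_cast [walkWeight_cons, SimpleGraph.Walk.length_cons]
      linarith
  have hl : (p.length : ℝ) ≤ Fintype.card V := by exact_mod_cast hp.length_lt.le
  have := key p
  have := gdist_le_walkWeight (w := w) p
  have := mul_le_mul_of_nonneg_right hl ht
  linarith

lemma gdist_le_card_mul [Fintype V] {t : ℝ} (p : G.Walk x y) (hp : p.IsPath) (ht : 0 ≤ t)
    (h : ∀ e ∈ p.edges, (w e : ℝ) ≤ t) : gdist G w x y ≤ Fintype.card V * t := by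
  have key : ∀ {a b : V} (q : G.Walk a b), (∀ e ∈ q.edges, (w e : ℝ) ≤ t) →
      (walkWeight w q : ℝ) ≤ q.length * t := by
    intro a b q hq
    induction q with
    | nil => simp
    | cons hab q ih =>
      have h1 := hq s(_, _) (List.mem_cons_self ..)
      have h2 := ih fun e he => hq e (by simp [he])
      push_cast [walkWeight_cons, SimpleGraph.Walk.length_cons]
      linarith
  have hl : (p.length : ℝ) ≤ Fintype.card V := by exact_mod_cast hp.length_lt.le
  exact (gdist_le_walkWeight p).trans ((key p h).trans (mul_le_mul_of_nonneg_right hl ht))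

end Distance

/-! ### Minimum spanning trees -/

section SpanningTree

variable {V : Type*} [Fintype V] {G : SimpleGraph V}

/-- `T` is a minimum spanning tree of `(G, w)`. -/
structure IsMST (G : SimpleGraph V) (w : Sym2 V → ℝ≥0) (T : SimpleGraph V) : Prop where
  le : T ≤ G
  isTree : T.IsTree
  min : ∀ T' ≤ G, T'.IsTree → totalWeight w T ≤ totalWeight w T'

lemma exists_isMST (hG : G.Connected) (w : Sym2 V → ℝ≥0) : ∃ T, IsMST G w T := by
  classical
  obtain ⟨T0, h0, h0'⟩ := hG.exists_isTree_le
  have : Nonempty {T : SimpleGraph V // T ≤ G ∧ T.IsTree} := ⟨⟨T0, h0, h0'⟩⟩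
  obtain ⟨T, hT⟩ := Finite.exists_min fun T : {T : SimpleGraph V // T ≤ G ∧ T.IsTree} =>
    totalWeight w T.1
  exact ⟨T.1, T.2.1, T.2.2, fun T' h h' => hT ⟨T', h, h'⟩⟩

lemma IsMST.mstWeight_eq {w : Sym2 V → ℝ≥0} {T : SimpleGraph V} (hT : IsMST G w T) :
    mstWeight G w = totalWeight w T := by
  refine le_antisymm (iInf_le_of_le ⟨T, hT.le, hT.isTree⟩ le_rfl) (le_iInf fun T' => ?_)
  exact_mod_cast hT.min T'.1 T'.2.1 T'.2.2

lemma totalWeight_eq_sum {w : Sym2 V → ℝ≥0} {H : SimpleGraph V} {s : Finset (Sym2 V)}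
    (hs : ∀ e, e ∈ s ↔ e ∈ H.edgeSet) : totalWeight w H = ∑ e ∈ s, w e := by
  classical
  exact Finset.sum_congr (by ext e; simp [hs]) fun _ _ => rfl

lemma totalWeight_mono {w : Sym2 V → ℝ≥0} {H K : SimpleGraph V} (h : H ≤ K) :
    totalWeight w H ≤ totalWeight w K := by
  classical
  exact Finset.sum_le_sum_of_subset (by simpa using h)

/-- Cycle property: each edge of `G` is a heaviest edge of the cycle that it closes in a minimum
spanning tree, since otherwise exchanging edges would give a lighter spanning tree. -/
lemma IsMST.le_of_mem_path {w : Sym2 V → ℝ≥0} {T : SimpleGraph V} (hT : IsMST G w T) {x y : V}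
    (hxy : G.Adj x y) {p : T.Walk x y} (hp : p.IsPath) {e : Sym2 V} (he : e ∈ p.edges) :
    w e ≤ w s(x, y) := by
  classical
  by_cases hT' : T.Adj x y
  · have : p = SimpleGraph.Walk.cons hT' .nil :=
      congrArg Subtype.val <| (hT.isTree.isAcyclic.subsingleton_path x y).elim ⟨p, hp⟩
        ⟨.cons hT' .nil, by simp [hxy.ne]⟩
    subst this
    simp at he
    simp [he]
  by_contra! hlt
  set K : SimpleGraph V := T ⊔ SimpleGraph.edge x y with hK
  have hTK : T ≤ K := le_sup_left
  have hKxy : K.Adj y x := by simp [hK, SimpleGraph.edge_adj, hxy.ne, hxy.ne']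
  have hKconn : K.Connected := hT.isTree.connected.mono hTK
  have heT : e ∈ T.edgeSet := p.edges_subset_edgeSet he
  have hne : e ≠ s(x, y) := by rintro rfl; exact hT' heT
  induction e with
  | h a b =>
  have hbr : ¬ K.IsBridge s(a, b) := by
    rw [SimpleGraph.isBridge_iff_forall_cycle_notMem (SimpleGraph.edgeSet_mono hTK heT)]
    push Not
    refine ⟨y, SimpleGraph.Walk.cons hKxy (p.mapLe hTK), ?_, ?_⟩
    · rw [SimpleGraph.Walk.cons_isCycle_iff]
      refine ⟨(SimpleGraph.Walk.isPath_mapLe hTK).2 hp, fun h => hT' ?_⟩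
      rw [SimpleGraph.Walk.edges_mapLe_eq_edges] at h
      simpa using (p.edges_subset_edgeSet h : s(y, x) ∈ T.edgeSet).symm
    · simp only [SimpleGraph.Walk.edges_cons, List.mem_cons]
      right
      rwa [SimpleGraph.Walk.edges_mapLe_eq_edges]
  have hconn := hKconn.connected_delete_edge_of_not_isBridge hbr
  obtain ⟨T', hT'le, hT'tree⟩ := hconn.exists_isTree_le
  have hKG : K ≤ G := sup_le hT.le (by
    rw [SimpleGraph.edge_le_iff]; exact Or.inr hxy)
  have h1 := hT.min T' (hT'le.trans ((SimpleGraph.deleteEdges_le _).trans hKG)) hT'tree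
  have h2 := totalWeight_mono (w := w) hT'le
  have h3 : totalWeight w (K.deleteEdges {s(a, b)}) + w s(a, b) = totalWeight w T + w s(x, y) := by
    have e1 : K.edgeFinset = insert s(x, y) T.edgeFinset := by
      ext e
      simp [hK, SimpleGraph.edgeSet_edge_of_ne hxy.ne]
    have e2 : (K.deleteEdges {s(a, b)}).edgeFinset = K.edgeFinset.erase s(a, b) := by
      ext e
      simp [and_comm]
    have e3 : s(a, b) ∈ K.edgeFinset := by
      rw [e1]; simp only [Finset.mem_insert, SimpleGraph.mem_edgeFinset]; exact Or.inr heT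
    rw [totalWeight_eq_sum (s := K.edgeFinset.erase s(a, b)) (fun e => by rw [← e2]; simp),
      Finset.sum_erase_add _ _ e3, e1, Finset.sum_insert (by simpa using hT'),
      add_comm, totalWeight_eq_sum (s := T.edgeFinset) (by simp)]
  have h4 := h1.trans h2
  have h5 : totalWeight w T + w s(x, y) < totalWeight w T + w s(a, b) := by gcongr
  exact absurd (h3 ▸ add_le_add_left h4 (w s(a, b))) (not_le.2 h5)

/-- Every edge of `G` is bridged in a minimum spanning tree by a path of edges that are not
heavier. -/
lemma IsMST.exists_path {w : Sym2 V → ℝ≥0} {T : SimpleGraph V} (hT : IsMST G w T) {x y : V}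
    (hxy : G.Adj x y) : ∃ p : T.Walk x y, p.IsPath ∧ ∀ e ∈ p.edges, w e ≤ w s(x, y) := by
  obtain ⟨p, hp, -⟩ := hT.isTree.existsUnique_path x y
  exact ⟨p, hp, fun e he => hT.le_of_mem_path hxy hp he⟩

end SpanningTree

/-! ### Packing separated points -/

section Packing

variable {V : Type*} {w : Sym2 V → ℝ≥0}

/-- The tent of height and radius `s / 2` around `p`. The tents around `s`-separated points have
disjoint supports. -/
noncomputable def tent (G : SimpleGraph V) (w : Sym2 V → ℝ≥0) (s : ℝ) (p x : V) : ℝ :=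
  max 0 (s / 2 - gdist G w p x)

/-- The variation of the tent around `p` along an edge. -/
noncomputable def tentVariation (G : SimpleGraph V) (w : Sym2 V → ℝ≥0) (s : ℝ) (p : V) :
    Sym2 V → ℝ :=
  Sym2.lift ⟨fun a b => |tent G w s p a - tent G w s p b|, fun _ _ => abs_sub_comm _ _⟩

lemma tentVariation_mk (G : SimpleGraph V) (s : ℝ) (p a b : V) :
    tentVariation G w s p s(a, b) = |tent G w s p a - tent G w s p b| := rfl

lemma tentVariation_nonneg (G : SimpleGraph V) (s : ℝ) (p : V) (e : Sym2 V) :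
    0 ≤ tentVariation G w s p e := by
  induction e with
  | h a b => exact abs_nonneg _

variable {T : SimpleGraph V}

lemma abs_tent_sub_le_sum {s : ℝ} {p x y : V} (q : T.Walk x y) :
    |tent T w s p x - tent T w s p y| ≤ (q.edges.map (tentVariation T w s p)).sum := by
  induction q with
  | nil => simp
  | @cons a b c h q ih =>
    simp only [SimpleGraph.Walk.edges_cons, List.map_cons, List.sum_cons, tentVariation_mk]
    exact (abs_sub_le _ (tent T w s p b) _).trans (by gcongr)

variable [Fintype V]

lemma sum_tentVariation_le (hT : T.Connected) {P : Finset V} {s : ℝ}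
    (hP : ∀ p ∈ P, ∀ q ∈ P, p ≠ q → s < gdist T w p q) {a b : V} (hab : T.Adj a b) :
    ∑ p ∈ P, tentVariation T w s p s(a, b) ≤ w s(a, b) := by
  classical
  have hd := gdist_le_of_adj (w := w) hab
  have hd' : gdist T w b a ≤ w s(a, b) := gdist_comm (G := T) ▸ hd
  have nn : ∀ p x, 0 ≤ tent T w s p x := fun p x => le_max_left _ _
  have pos : ∀ {p x}, 0 < tent T w s p x → tent T w s p x = s / 2 - gdist T w p x := by
    intro p x h
    rcases max_choice 0 (s / 2 - gdist T w p x) with h' | h'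
    · rw [tent, h'] at h; exact absurd h (lt_irrefl _)
    · exact h'
  have excl : ∀ {p q x}, p ∈ P → q ∈ P → 0 < tent T w s p x → 0 < tent T w s q x → p = q := by
    intro p q x hp hq h1 h2
    by_contra hne
    have h3 := hP p hp q hq hne
    have h4 := gdist_triangle (w := w) hT (x := p) (y := x) (z := q)
    have h5 := gdist_comm (G := T) (w := w) (x := x) (y := q)
    have := pos h1
    have := pos h2
    linarith
  have lip : ∀ p, tentVariation T w s p s(a, b) ≤ w s(a, b) := by
    intro p
    rw [tentVariation_mk, tent, tent]
    have h1 := gdist_triangle (w := w) hT (x := p) (y := a) (z := b)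
    have h2 := gdist_triangle (w := w) hT (x := p) (y := b) (z := a)
    rw [max_comm 0, max_comm 0]
    refine (abs_max_sub_max_le_abs _ _ _).trans ?_
    rw [abs_le]
    constructor <;> linarith
  have zero : ∀ {p x}, ¬ 0 < tent T w s p x → tent T w s p x = 0 :=
    fun h => le_antisymm (not_lt.1 h) (nn _ _)
  by_cases h : ∃ p ∈ P, 0 < tent T w s p a ∧ ∃ q ∈ P, q ≠ p ∧ 0 < tent T w s q b
  · obtain ⟨p, hp, hpa, q, hq, hqp, hqb⟩ := h
    have hpb : tent T w s p b = 0 := zero fun h => hqp (excl hq hp hqb h)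
    have hqa : tent T w s q a = 0 := zero fun h => hqp (excl hq hp h hpa)
    have hsub : ({p, q} : Finset V) ⊆ P := by
      intro x hx
      rcases Finset.mem_insert.1 hx with rfl | hx
      · exact hp
      · exact (Finset.mem_singleton.1 hx) ▸ hq
    rw [← Finset.sum_subset hsub, Finset.sum_pair hqp.symm]
    · rw [tentVariation_mk, tentVariation_mk, hpb, hqa, sub_zero, zero_sub, abs_neg,
        abs_of_nonneg (nn _ _), abs_of_nonneg (nn _ _), pos hpa, pos hqb]
      have h1 := hP p hp q hq hqp.symm
      have h2 := gdist_triangle (w := w) hT (x := p) (y := a) (z := q)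
      have h3 := gdist_triangle (w := w) hT (x := a) (y := b) (z := q)
      have h4 := gdist_comm (G := T) (w := w) (x := b) (y := q)
      linarith
    · intro x hx hx'
      simp only [Finset.mem_insert, Finset.mem_singleton, not_or] at hx'
      rw [tentVariation_mk, zero fun h => hx'.1 (excl hx hp h hpa),
        zero fun h => hx'.2 (excl hx hq h hqb), sub_zero, abs_zero]
  · have uniq : ∀ p ∈ P, ∀ q ∈ P, tentVariation T w s p s(a, b) ≠ 0 →
        tentVariation T w s q s(a, b) ≠ 0 → q = p := by
      intro p hp q hq h1 h2
      have aux : ∀ p, tentVariation T w s p s(a, b) ≠ 0 →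
          0 < tent T w s p a ∨ 0 < tent T w s p b := by
        intro p h
        by_contra! h'
        rw [tentVariation_mk, zero h'.1.not_gt, zero h'.2.not_gt] at h
        simp at h
      by_contra hne
      rcases aux p h1 with h1 | h1 <;> rcases aux q h2 with h2 | h2
      · exact hne (excl hq hp h2 h1)
      · exact h ⟨p, hp, h1, q, hq, hne, h2⟩
      · exact h ⟨q, hq, h2, p, hp, Ne.symm hne, h1⟩
      · exact hne (excl hq hp h2 h1)
    by_cases hz : ∃ p ∈ P, tentVariation T w s p s(a, b) ≠ 0
    · obtain ⟨p, hp, hp'⟩ := hz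
      rw [Finset.sum_eq_single_of_mem p hp fun q hq hne => ?_]
      · exact lip p
      · by_contra hc
        exact hne (uniq p hp q hq hp' hc)
    · push Not at hz
      rw [Finset.sum_eq_zero hz]
      exact NNReal.coe_nonneg _

open scoped Classical in
/-- Packing bound: at least two `s`-separated points of a connected graph force it to have weight at
least `s / 2` per point. The tents around the points have disjoint supports, each of them varies by
at least `s / 2`, and together they vary by at most `w e` along each edge `e`. -/
lemma card_mul_le_of_separated (hT : T.Connected) {P : Finset V} {s : ℝ} (hs : 0 ≤ s)
    (hP : ∀ p ∈ P, ∀ q ∈ P, p ≠ q → s < gdist T w p q) (h2 : 1 < P.card) :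
    P.card * s ≤ 2 * totalWeight w T := by
  have h : ∀ p ∈ P, s / 2 ≤ ∑ e ∈ T.edgeFinset, tentVariation T w s p e := by
    intro p hp
    obtain ⟨q, hq, hqp⟩ := Finset.exists_mem_ne h2 p
    obtain ⟨W, hW, -⟩ := exists_path_walkWeight_eq_gdist hT w p q
    have h1 := abs_tent_sub_le_sum (w := w) (s := s) (p := p) W
    have hpp : tent T w s p p = s / 2 := by simp [tent]; linarith
    have hpq : tent T w s p q = 0 := by
      have := hP p hp q hq hqp.symm
      rw [tent, max_eq_left]; linarith
    rw [hpp, hpq, sub_zero, abs_of_nonneg (by positivity)] at h1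
    refine h1.trans ?_
    rw [← List.sum_toFinset _ hW.isTrail.edges_nodup]
    refine Finset.sum_le_sum_of_subset_of_nonneg (fun e he => ?_)
      fun e _ _ => tentVariation_nonneg _ _ _ _
    simpa using W.edges_subset_edgeSet (by simpa using he)
  have h3 := Finset.sum_le_sum h
  rw [Finset.sum_const, nsmul_eq_mul, Finset.sum_comm] at h3
  have h4 : ∑ e ∈ T.edgeFinset, ∑ p ∈ P, tentVariation T w s p e ≤ ∑ e ∈ T.edgeFinset, (w e : ℝ) := by
    refine Finset.sum_le_sum fun e he => ?_
    induction e with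
    | h a b => exact sum_tentVariation_le hT hP (by simpa using he)
  have h5 : ((totalWeight w T : ℝ≥0) : ℝ) = ∑ e ∈ T.edgeFinset, (w e : ℝ) := by
    simp [totalWeight]
  linarith

end Packing

/-! ### Hierarchies of centers -/

section Hierarchy

variable {V : Type*}

/-- A maximal `s`-separated subset of `S` covers `S` within distance `s`. -/
lemma exists_net {D : V → V → ℝ} {s : ℝ} (hD : ∀ x, D x x ≤ s) (hsymm : ∀ x y, D x y = D y x)
    (S : Finset V) : ∃ N ⊆ S, (∀ x ∈ N, ∀ y ∈ N, x ≠ y → s < D x y) ∧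
      ∀ x ∈ S, ∃ y ∈ N, D x y ≤ s := by
  classical
  induction S using Finset.induction_on with
  | empty => exact ⟨∅, by simp⟩
  | insert a S ha ih =>
    obtain ⟨N, hNS, hsep, hcov⟩ := ih
    by_cases h : ∃ y ∈ N, D a y ≤ s
    · refine ⟨N, hNS.trans (Finset.subset_insert _ _), hsep, fun x hx => ?_⟩
      rcases Finset.mem_insert.1 hx with rfl | hx
      exacts [h, hcov x hx]
    · push Not at h
      refine ⟨insert a N, Finset.insert_subset_insert _ hNS, ?_, fun x hx => ?_⟩
      · intro x hx y hy hxy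
        rcases Finset.mem_insert.1 hx with hx | hxN <;> rcases Finset.mem_insert.1 hy with hy | hyN
        · exact absurd (hx.trans hy.symm) hxy
        · exact hx ▸ h y hyN
        · exact hsymm y x ▸ hy ▸ h x hxN
        · exact hsep x hxN y hyN hxy
      · rcases Finset.mem_insert.1 hx with rfl | hx
        · exact ⟨x, Finset.mem_insert_self _ _, hD x⟩
        · obtain ⟨y, hy, hy'⟩ := hcov x hx
          exact ⟨y, Finset.mem_insert_of_mem hy, hy'⟩

open scoped Classical in
/-- The points of `S` that have more than `X` points of `S` within distance `2 ρ`. -/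
noncomputable def popular (D : V → V → ℝ) (X ρ : ℝ) (S : Finset V) : Finset V :=
  S.filter fun c => X < ((S.filter fun c' => D c c' ≤ 2 * ρ).card : ℝ)

lemma popular_subset (D : V → V → ℝ) (X ρ : ℝ) (S : Finset V) : popular D X ρ S ⊆ S :=
  Finset.filter_subset _ _

/-- A hierarchy of centers for the radii `ρ i`: the centers of level `i + 1` form a maximal
`4 ρ i`-separated set of popular centers of level `i`. -/
structure IsHierarchy (D : V → V → ℝ) (X : ℝ) (ρ : ℕ → ℝ) (P : ℕ → Finset V) : Prop where
  subset : ∀ i, P (i + 1) ⊆ popular D X (ρ i) (P i)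
  separated : ∀ i, ∀ x ∈ P (i + 1), ∀ y ∈ P (i + 1), x ≠ y → 4 * ρ i < D x y
  cover : ∀ i, ∀ x ∈ popular D X (ρ i) (P i), ∃ y ∈ P (i + 1), D x y ≤ 4 * ρ i

lemma exists_isHierarchy {D : V → V → ℝ} (hD : ∀ x, D x x = 0) (hsymm : ∀ x y, D x y = D y x)
    (X : ℝ) {ρ : ℕ → ℝ} (hρ : ∀ i, 0 ≤ ρ i) (P₀ : Finset V) :
    ∃ P : ℕ → Finset V, P 0 = P₀ ∧ IsHierarchy D X ρ P := by
  have h : ∀ i (S : Finset V), ∃ N ⊆ popular D X (ρ i) S,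
      (∀ x ∈ N, ∀ y ∈ N, x ≠ y → 4 * ρ i < D x y) ∧
      ∀ x ∈ popular D X (ρ i) S, ∃ y ∈ N, D x y ≤ 4 * ρ i := fun i S =>
    exists_net (fun x => by rw [hD]; have := hρ i; positivity) hsymm _
  choose f h1 h2 h3 using h
  exact ⟨fun i => Nat.rec P₀ f i, rfl, fun i => h1 i _, fun i => h2 i _, fun i => h3 i _⟩

variable {D : V → V → ℝ} {X : ℝ} {ρ : ℕ → ℝ} {P : ℕ → Finset V}

/-- Each level of the hierarchy has at most a `1 / X` fraction of the centers of the previous one,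
because the balls of radius `2 ρ i` around its centers are disjoint. -/
lemma IsHierarchy.card_succ_mul_le (hP : IsHierarchy D X ρ P) (hsymm : ∀ x y, D x y = D y x)
    (htri : ∀ x y z, D x z ≤ D x y + D y z) (i : ℕ) :
    ((P (i + 1)).card : ℝ) * X ≤ (P i).card := by
  classical
  set B : V → Finset V := fun c => (P i).filter fun c' => D c c' ≤ 2 * ρ i with hB
  have h1 : ((P (i + 1)).biUnion B).card = ∑ c ∈ P (i + 1), (B c).card := by
    refine Finset.card_biUnion fun x hx y hy hxy => ?_
    refine Finset.disjoint_left.2 fun z hz hz' => ?_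
    simp only [hB, Finset.mem_filter] at hz hz'
    have := hP.separated i x hx y hy hxy
    have := htri x z y
    have := hsymm z y
    linarith [hz.2, hz'.2]
  have h2 : ((P (i + 1)).biUnion B).card ≤ (P i).card :=
    Finset.card_le_card (Finset.biUnion_subset.2 fun c _ => Finset.filter_subset _ _)
  have h3 : ((P (i + 1)).card : ℝ) * X ≤ ∑ c ∈ P (i + 1), ((B c).card : ℝ) := by
    rw [← nsmul_eq_mul, ← Finset.sum_const]
    refine Finset.sum_le_sum fun c hc => ?_
    have := hP.subset i hc
    simp only [popular, Finset.mem_filter] at this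
    exact this.2.le
  rw [h1] at h2
  exact h3.trans (by exact_mod_cast h2)

/-- Level `k - 1` has no popular centers if `X ^ k` is at least the number of vertices. -/
lemma IsHierarchy.popular_eq_empty [Fintype V] (hP : IsHierarchy D X ρ P)
    (hsymm : ∀ x y, D x y = D y x) (htri : ∀ x y z, D x z ≤ D x y + D y z) (hX : 1 ≤ X) {k : ℕ}
    (hk : (Fintype.card V : ℝ) ≤ X ^ (k + 1)) : popular D X (ρ k) (P k) = ∅ := by
  have h : ∀ i, ((P i).card : ℝ) * X ^ i ≤ Fintype.card V := by
    intro i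
    induction i with
    | zero => simpa using Finset.card_le_univ (P 0)
    | succ i ih =>
      refine le_trans ?_ ih
      rw [pow_succ', ← mul_assoc]
      exact mul_le_mul_of_nonneg_right (hP.card_succ_mul_le hsymm htri i) (by positivity)
  refine Finset.eq_empty_of_forall_notMem fun c hc => ?_
  simp only [popular, Finset.mem_filter] at hc
  have h1 : X < ((P k).card : ℝ) := hc.2.trans_le (by
    exact_mod_cast Finset.card_le_card (Finset.filter_subset _ _))
  have h2 := mul_lt_mul_of_pos_right h1 (show 0 < X ^ k by positivity)
  have := h k
  rw [pow_succ'] at hk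
  linarith

end Hierarchy

/-! ### The stretch along a path with levels -/

section Stretch

/-- Closing the gap between two positions `p < q` that are separated only by positions of level
below `i`. -/
lemma stretch_gap {d : ℕ → ℕ → ℝ} {t : ℕ → ℝ} {lev : ℕ → ℕ} {R c : ℝ} {m i : ℕ} {α : ℝ}
    (htri : ∀ a b c, d a c ≤ d a b + d b c) (hα : 1 ≤ α) (ht : Monotone t) (hR : 0 ≤ R) (hc : 0 ≤ c)
    (hstep : ∀ a < m, lev a ≤ i → lev (a + 1) ≤ i → d a (a + 1) ≤ t (a + 1) - t a + 4 * R)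
    (ih : ∀ a b, a ≤ b → b ≤ m → (∀ j, a ≤ j → j ≤ b → lev j < i) →
      d a b ≤ α * (t b - t a) + c)
    {p q : ℕ} (hpq : p < q) (hq : q ≤ m) (hlp : lev p ≤ i) (hlq : lev q ≤ i)
    (hbetween : ∀ j, p < j → j < q → lev j < i) :
    d p q ≤ α * (t q - t p) + c + 8 * R := by
  have up : ∀ a b, a ≤ b → t b - t a ≤ α * (t b - t a) := fun a b hab => by
    have := ht hab
    nlinarith
  rcases Nat.lt_or_ge (p + 1) q with h | h
  · have h1 := hstep p (by omega) hlp (hbetween (p + 1) (by omega) h).le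
    have h2 := hstep (q - 1) (by omega) (hbetween (q - 1) (by omega) (by omega)).le
      (by rwa [Nat.sub_add_cancel (by omega)])
    rw [Nat.sub_add_cancel (by omega)] at h2
    have h3 := ih (p + 1) (q - 1) (by omega) (by omega) fun j hj hj' =>
      hbetween j (by omega) (by omega)
    have h4 := htri p (p + 1) q
    have h5 := htri (p + 1) (q - 1) q
    have h6 := up p (p + 1) (by omega)
    have h7 := up (q - 1) q (by omega)
    linarith
  · obtain rfl : q = p + 1 := by omega
    have h1 := hstep p (by omega) hlp hlq
    have h6 := up p (p + 1) (by omega)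
    linarith

/-- The stretch bound for a path, abstracted to the positions `0, ..., m` on it. The position `a`
lies at distance `t a` from the start and has a level `lev a`; `d` bounds the distances in the
spanner. Two positions whose lower level is `h` are joined in the spanner with additive error
`4 R h` if their distance on the path is at most `σ h`. The additive error `4 R h` made by a jump of
length about `σ h` is absorbed by the factor `1 + η`, and a jump that is shorter because no position
of level `h` is found near `σ h` is followed by a long piece of lower level, where induction on the
level applies. -/
lemma stretch_of_levels {d : ℕ → ℕ → ℝ} {t : ℕ → ℝ} {lev : ℕ → ℕ} {R σ B : ℕ → ℝ} {m k : ℕ}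
    {η : ℝ} (htri : ∀ a b c, d a c ≤ d a b + d b c) (ht : Monotone t)
    (hη : 0 ≤ η) (hR : ∀ h, 0 ≤ R h) (hRmono : Monotone R) (hBnn : ∀ i, 0 ≤ B i)
    (hB : ∀ i, 2 * B i + 16 * R i ≤ B (i + 1))
    (hσ : ∀ i, B i + 12 * R i ≤ η * σ i) (hσ0 : ∀ i, 0 ≤ σ i)
    (hjump : ∀ a b, a ≤ b → b ≤ m → t b - t a ≤ σ (min (lev a) (lev b)) →
      d a b ≤ t b - t a + 4 * R (min (lev a) (lev b)))
    (hstep : ∀ a < m, ∀ i, t (a + 1) - t a ≤ σ i)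
    (hlev : ∀ a ≤ m, lev a < k) :
    d 0 m ≤ (1 + k * η) * (t m - t 0) + B k := by

  have main : ∀ i, ∀ a b, a ≤ b → b ≤ m → (∀ j, a ≤ j → j ≤ b → lev j < i) →
      d a b ≤ (1 + i * η) * (t b - t a) + B i := by
    intro i
    induction i with
    | zero => intro a b hab _ h; exact absurd (h a le_rfl hab) (by omega)
    | succ i ih =>
      have hα : 1 ≤ 1 + (i : ℝ) * η := le_add_of_nonneg_right (by positivity)
      have hs : ∀ a < m, lev a ≤ i → lev (a + 1) ≤ i →
          d a (a + 1) ≤ t (a + 1) - t a + 4 * R i := fun a ha h1 _ => by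
        have h3 := hjump a (a + 1) (by omega) (by omega) (hstep a ha _)
        have h4 : R (min (lev a) (lev (a + 1))) ≤ R i := hRmono ((min_le_left _ _).trans h1)
        linarith
      have gap := fun p q => @stretch_gap d t lev (R i) (B i) m i _ htri hα ht (hR i) (hBnn i) hs ih
        p q
      push_cast
      -- the case of a piece that starts at a position of level `i`
      have S : ∀ n z b, b - z = n → z ≤ b → b ≤ m → lev z = i →
          (∀ j, z ≤ j → j ≤ b → lev j ≤ i) →
          d z b ≤ (1 + (i + 1) * η) * (t b - t z) + B i + 8 * R i + 4 * R i := by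
        intro n
        induction n using Nat.strong_induction_on with
        | _ n ihn =>
        intro z b hn hzb hbm hz hl
        -- the last position of level `i` within distance `σ i`
        obtain ⟨y, ⟨hzy, hyb, hly, hty⟩, hmax⟩ : ∃ y, (z ≤ y ∧ y ≤ b ∧ lev y = i ∧
            t y - t z ≤ σ i) ∧ ∀ j, y < j → j ≤ b → lev j = i → σ i < t j - t z := by
          classical
          set F := (Finset.Icc z b).filter fun y => lev y = i ∧ t y - t z ≤ σ i with hF
          have hne : F.Nonempty := ⟨z, by simp [hF, hzb, hz, hσ0]⟩
          refine ⟨F.max' hne, ?_, fun j hj hjb hlj => ?_⟩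
          · have := F.max'_mem hne
            simp only [hF, Finset.mem_filter, Finset.mem_Icc] at this
            tauto
          · by_contra! hc
            have hjF : j ∈ F := by
              have := F.max'_mem hne
              simp only [hF, Finset.mem_filter, Finset.mem_Icc] at this ⊢
              exact ⟨⟨this.1.1.trans hj.le, hjb⟩, hlj, hc⟩
            exact absurd (F.le_max' j hjF) (not_le.2 hj)
        have hmin : min (lev z) (lev y) = i := by rw [hz, hly, min_self]
        have j1 := hjump z y hzy (hyb.trans hbm) (by rw [hmin]; exact hty)
        rw [hmin] at j1
        have m1 := ht hzy
        have m2 := ht hyb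
        have hRi := hR i
        have hBi := hBnn i
        by_cases hnext : ∃ j, y < j ∧ j ≤ b ∧ lev j = i
        · classical
          obtain ⟨h1, h2, h3⟩ := Nat.find_spec hnext
          set y' := Nat.find hnext with hy'
          have hb : ∀ j, y < j → j < y' → lev j < i := by
            intro j hj hj'
            refine lt_of_le_of_ne (hl j (by omega) (by omega)) fun h => ?_
            exact Nat.find_min hnext hj' ⟨hj, by omega, h⟩
          have j2 := gap y y' h1 (h2.trans hbm) hly.le h3.le hb
          have j3 := ihn (b - y') (by omega) y' b rfl h2 hbm h3 fun j hj hj' =>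
            hl j (by omega) hj'
          have j4 := hmax y' h1 h2 h3
          have j5 := hσ i
          have j6 := mul_le_mul_of_nonneg_left j4.le hη
          have j7 := htri z y b
          have j8 := htri y y' b
          have j9 : 0 ≤ (i : ℝ) * η * (t y - t z) := mul_nonneg (by positivity) (by linarith)
          linarith
        · push Not at hnext
          have j10 : 0 ≤ (i : ℝ) * η * (t y - t z) := mul_nonneg (by positivity) (by linarith)
          have j11 : 0 ≤ η * (t y - t z) := mul_nonneg hη (by linarith)
          have j12 : 0 ≤ η * (t b - t y) := mul_nonneg hη (by linarith)
          rcases eq_or_lt_of_le hyb with rfl | hlt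
          · linarith
          · have j2 := gap y b hlt hbm hly.le (hl b hzb le_rfl) fun j hj hj' =>
              lt_of_le_of_ne (hl j (by omega) (by omega)) (hnext j hj (by omega))
            have j7 := htri z y b
            linarith
      intro a b hab hbm hl
      have mab := ht hab
      have hRi := hR i
      have hBi := hBnn i
      have hBs := hB i
      by_cases hex : ∃ z, a ≤ z ∧ z ≤ b ∧ lev z = i
      · classical
        obtain ⟨h1, h2, h3⟩ := Nat.find_spec hex
        set z := Nat.find hex with hz
        have hb : ∀ j, a ≤ j → j < z → lev j < i := by
          intro j hj hj'
          refine lt_of_le_of_ne (Nat.lt_succ_iff.1 (hl j hj (by omega))) fun h => ?_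
          exact Nat.find_min hex hj' ⟨hj, by omega, h⟩
        have j1 := S _ z b rfl h2 hbm h3 fun j hj hj' => Nat.lt_succ_iff.1 (hl j (by omega) hj')
        have mz := ht h1
        have j12 : 0 ≤ η * (t z - t a) := mul_nonneg hη (by linarith)
        rcases eq_or_lt_of_le h1 with h | h
        · rw [← h] at j1; linarith
        · have j2 := ih a (z - 1) (by omega) (by omega) fun j hj hj' => hb j hj (by omega)
          have j3 := hs (z - 1) (by omega) (hb (z - 1) (by omega) (by omega)).le
            (by rw [Nat.sub_add_cancel (by omega)]; exact h3.le)
          rw [Nat.sub_add_cancel (by omega)] at j3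
          have j4 := htri a (z - 1) b
          have j5 := htri (z - 1) z b
          have j6 : 0 ≤ η * (t (z - 1) - t a) := mul_nonneg hη (by
            have := ht (show a ≤ z - 1 by omega); linarith)
          have j7 : 0 ≤ (1 + i) * η * (t z - t (z - 1)) := mul_nonneg (by positivity) (by
            have := ht (show z - 1 ≤ z by omega); linarith)
          linarith
      · push Not at hex
        have j1 := ih a b hab hbm fun j hj hj' =>
          lt_of_le_of_ne (Nat.lt_succ_iff.1 (hl j hj hj')) (hex j hj hj')
        have j12 : 0 ≤ η * (t b - t a) := mul_nonneg hη (by linarith)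
        linarith
  exact main k 0 m (Nat.zero_le _) le_rfl fun j _ hj => hlev j hj

end Stretch

/-! ### Rounding light edges to zero -/

section Rounding

variable {V : Type*} {G T : SimpleGraph V} {w : Sym2 V → ℝ≥0} {θ : ℝ}

open scoped Classical in
/-- The weight in which edges of weight at most `θ` are free. -/
noncomputable def roundWeight (w : Sym2 V → ℝ≥0) (θ : ℝ) (e : Sym2 V) : ℝ≥0 :=
  if (w e : ℝ) ≤ θ then 0 else w e

lemma roundWeight_le (e : Sym2 V) : roundWeight w θ e ≤ w e := by
  unfold roundWeight; split_ifs <;> simp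

lemma le_roundWeight_add (hθ : 0 ≤ θ) (e : Sym2 V) : (w e : ℝ) ≤ roundWeight w θ e + θ := by
  unfold roundWeight; split_ifs <;> simp_all

lemma lt_of_roundWeight_pos {e : Sym2 V} (h : 0 < roundWeight w θ e) :
    θ < w e ∧ roundWeight w θ e = w e := by
  unfold roundWeight at h ⊢
  split_ifs at h ⊢ with h'
  · exact absurd h (lt_irrefl _)
  · exact ⟨not_le.1 h', rfl⟩

lemma roundWeight_eq_zero_iff (hθ : 0 ≤ θ) {e : Sym2 V} :
    roundWeight w θ e = 0 ↔ (w e : ℝ) ≤ θ := by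
  unfold roundWeight
  split_ifs with h
  · simp [h]
  · simp only [h, iff_false]
    rintro h'
    simp [h'] at h
    linarith

variable [Fintype V]

/-- Vertices at rounded distance zero in `G` are at rounded distance zero in a minimum spanning
tree. -/
lemma IsMST.gdist_roundWeight_eq_zero (hT : IsMST G w T) (hθ : 0 ≤ θ) {x y : V}
    (h : gdist G (roundWeight w θ) x y = 0) : gdist T (roundWeight w θ) x y = 0 := by
  obtain ⟨p, -, hp⟩ := exists_path_walkWeight_eq_gdist (hT.isTree.connected.mono hT.le)
    (roundWeight w θ) x y
  rw [h, NNReal.coe_eq_zero] at hp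
  clear h
  induction p with
  | nil => simp
  | @cons a b c hab p ih =>
    rw [walkWeight_cons, add_eq_zero, roundWeight_eq_zero_iff hθ] at hp
    have h1 := ih hp.2
    obtain ⟨q, -, hq⟩ := hT.exists_path hab
    have h2 : gdist T (roundWeight w θ) a b ≤ 0 := by
      refine (gdist_le_walkWeight q).trans ?_
      refine le_of_eq (NNReal.coe_eq_zero.2 ?_)
      refine List.sum_eq_zero fun z hz => ?_
      obtain ⟨e, he, rfl⟩ := List.mem_map.1 hz
      rw [roundWeight_eq_zero_iff hθ]
      exact le_trans (by exact_mod_cast hq e he) hp.1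
    have h3 := gdist_triangle (w := roundWeight w θ) hT.isTree.connected (x := a) (y := b) (z := c)
    exact le_antisymm (by linarith) gdist_nonneg

end Rounding

/-! ### Distance to a set of sources -/

section SetDist

variable {V : Type*} {G : SimpleGraph V} {w : Sym2 V → ℝ≥0} {S : Finset V} {x y : V}

/-- The distance from `x` to a finite set `S` of vertices (`0` if `S` is empty). -/
noncomputable def setDist (G : SimpleGraph V) (w : Sym2 V → ℝ≥0) (S : Finset V) (x : V) : ℝ :=
  if h : S.Nonempty then S.inf' h (gdist G w x) else 0

lemma setDist_le {s : V} (hs : s ∈ S) : setDist G w S x ≤ gdist G w x s := by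
  rw [setDist, dif_pos ⟨s, hs⟩]
  exact Finset.inf'_le _ hs

lemma exists_setDist_eq (hS : S.Nonempty) (x : V) : ∃ s ∈ S, setDist G w S x = gdist G w x s := by
  rw [setDist, dif_pos hS]
  exact Finset.exists_mem_eq_inf' hS _

@[simp] lemma setDist_singleton (c : V) : setDist G w {c} x = gdist G w x c := by
  simp [setDist]

lemma setDist_nonneg : 0 ≤ setDist G w S x := by
  by_cases hS : S.Nonempty
  · obtain ⟨s, -, h⟩ := exists_setDist_eq (G := G) (w := w) hS x
    exact h ▸ gdist_nonneg
  · rw [setDist, dif_neg hS]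

lemma setDist_le_add [Finite V] (hG : G.Connected) :
    setDist G w S x ≤ gdist G w x y + setDist G w S y := by
  by_cases hS : S.Nonempty
  · obtain ⟨s, hs, h⟩ := exists_setDist_eq (G := G) (w := w) hS y
    rw [h]
    exact (setDist_le hs).trans (gdist_triangle hG)
  · rw [setDist, dif_neg hS, setDist, dif_neg hS, add_zero]
    exact gdist_nonneg

end SetDist

/-! ### Routes along parent edges -/

section Routes

variable {V : Type*} {G T : SimpleGraph V} {w : Sym2 V → ℝ≥0}

/-- A choice of a representative `rep x` of each class of vertices at distance zero from each other,
and for each set `S` of sources and each vertex `x` outside of the classes of `S` of an edge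
`par S x` of positive weight that is the last such edge on a shortest path from `S` to the class of
`x`. -/
structure IsParentSystem (G : SimpleGraph V) (w : Sym2 V → ℝ≥0) (rep : V → V)
    (par : Finset V → V → Sym2 V) : Prop where
  rep_dist : ∀ x, gdist G w (rep x) x = 0
  rep_eq : ∀ x y, gdist G w x y = 0 → rep x = rep y
  par_spec : ∀ S : Finset V, S.Nonempty → ∀ x, 0 < setDist G w S x → ∃ y z, G.Adj y z ∧
    par S x = s(y, z) ∧ gdist G w z x = 0 ∧ 0 < w s(y, z) ∧
    setDist G w S y + w s(y, z) = setDist G w S x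

/-- `F` consists of parent edges for the sources `S`, weighs at most the distance from `x` to `S`,
and together with `T` realizes that distance. -/
structure IsRoute (G T : SimpleGraph V) (w : Sym2 V → ℝ≥0) (rep : V → V)
    (par : Finset V → V → Sym2 V) (S : Finset V) (x : V) (F : Finset (Sym2 V)) : Prop where
  mem : ∀ e ∈ F, ∃ q, rep q = q ∧ 0 < setDist G w S q ∧ setDist G w S q ≤ setDist G w S x ∧
    e = par S q
  sum_le : ((∑ e ∈ F, w e : ℝ≥0) : ℝ) ≤ setDist G w S x
  reach : ∀ K, T ≤ K → (∀ e ∈ F, e ∈ K.edgeSet) → ∃ s ∈ S, gdist K w x s ≤ setDist G w S x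

lemma IsRoute.eq_empty {S : Finset V} {x : V} {F : Finset (Sym2 V)} {rep : V → V}
    {par : Finset V → V → Sym2 V} (h : IsRoute G T w rep par S x F)
    (hx : setDist G w S x = 0) : F = ∅ := by
  refine Finset.eq_empty_of_forall_notMem fun e he => ?_
  obtain ⟨q, -, h1, h2, -⟩ := h.mem e he
  linarith

variable [Finite V]

lemma exists_parent (hG : G.Connected) {S : Finset V} (hS : S.Nonempty) {x : V}
    (hx : 0 < setDist G w S x) : ∃ y z, G.Adj y z ∧ gdist G w z x = 0 ∧ 0 < w s(y, z) ∧
      setDist G w S y + w s(y, z) = setDist G w S x := by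
  obtain ⟨s, hs, hsx⟩ := exists_setDist_eq (G := G) (w := w) hS x
  obtain ⟨p, -, hp⟩ := exists_path_walkWeight_eq_gdist hG w x s
  rw [← hsx] at hp
  clear hsx
  induction p with
  | @nil a =>
    have := setDist_le (G := G) (w := w) (x := a) hs
    rw [gdist_self] at this
    linarith
  | @cons a b c hab p ih =>
    rw [walkWeight_cons, NNReal.coe_add] at hp
    have h1 : setDist G w S b ≤ walkWeight w p := (setDist_le hs).trans (gdist_le_walkWeight p)
    have h2 := setDist_le_add (w := w) hG (S := S) (x := a) (y := b)
    have h3 := gdist_le_of_adj (w := w) hab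
    rcases (w s(a, b)).2.eq_or_lt with h0 | h0
    · have h0' : ((w s(a, b) : ℝ≥0) : ℝ) = 0 := h0.symm
      rw [h0'] at h3 hp
      obtain ⟨y, z, hyz, hz, hw, he⟩ := ih (by linarith) hs (by linarith)
      refine ⟨y, z, hyz, le_antisymm ?_ gdist_nonneg, hw, by linarith⟩
      have h4 := gdist_triangle (w := w) hG (x := z) (y := b) (z := a)
      rw [gdist_comm (x := b)] at h4
      linarith
    · exact ⟨b, a, hab.symm, gdist_self, Sym2.eq_swap ▸ h0, by rw [Sym2.eq_swap]; linarith⟩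

lemma exists_isParentSystem (hG : G.Connected) (w : Sym2 V → ℝ≥0) :
    ∃ rep par, IsParentSystem G w rep par := by
  classical
  let Z : Setoid V :=
    { r := fun x y => gdist G w x y = 0
      iseqv :=
        { refl := fun x => gdist_self
          symm := fun h => gdist_comm (G := G) ▸ h
          trans := fun {x y z} h h' => le_antisymm
            ((gdist_triangle hG (y := y)).trans (by rw [h, h', add_zero])) gdist_nonneg } }
  have h : ∀ (S : Finset V) (x : V), ∃ e : Sym2 V, S.Nonempty → 0 < setDist G w S x →
      ∃ y z, G.Adj y z ∧ e = s(y, z) ∧ gdist G w z x = 0 ∧ 0 < w s(y, z) ∧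
        setDist G w S y + w s(y, z) = setDist G w S x := by
    intro S x
    by_cases hS : S.Nonempty ∧ 0 < setDist G w S x
    · obtain ⟨y, z, h1, h2⟩ := exists_parent hG hS.1 hS.2
      exact ⟨s(y, z), fun _ _ => ⟨y, z, h1, rfl, h2⟩⟩
    · exact ⟨s(x, x), fun h1 h2 => absurd ⟨h1, h2⟩ hS⟩
  choose par hpar using h
  exact ⟨fun x => (Quotient.mk Z x).out, par, fun x => Quotient.mk_out (s := Z) x,
    fun x y hxy => congrArg Quotient.out (Quotient.sound (s := Z) hxy), fun S hS x => hpar S x hS⟩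

lemma IsParentSystem.exists_isRoute {rep : V → V} {par : Finset V → V → Sym2 V}
    (h : IsParentSystem G w rep par) (hG : G.Connected) (hT : T.Connected)
    (hzero : ∀ x y, gdist G w x y = 0 → gdist T w x y = 0) {S : Finset V} (hS : S.Nonempty)
    (x : V) : ∃ F, IsRoute G T w rep par S x F := by
  classical
  have wf : WellFounded fun a b => setDist G w S a < setDist G w S b :=
    haveI : IsTrans V (fun a b => setDist G w S a < setDist G w S b) :=
      ⟨fun _ _ _ h h' => lt_trans h h'⟩
    haveI : Std.Irrefl (fun a b => setDist G w S a < setDist G w S b) := ⟨fun _ => lt_irrefl _⟩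
    Finite.wellFounded_of_trans_of_irrefl _
  induction x using wf.induction with
  | _ x ih =>
  rcases setDist_nonneg (G := G) (w := w) (S := S) (x := x) |>.eq_or_lt with h0 | h0
  · obtain ⟨s, hs, hsx⟩ := exists_setDist_eq (G := G) (w := w) hS x
    refine ⟨∅, by simp, by simp [← h0], fun K hK _ => ⟨s, hs, ?_⟩⟩
    rw [← h0]
    have := hzero x s (by rw [← hsx, h0])
    exact this ▸ gdist_anti hT hK
  · -- step from the class of `x` along the parent edge of its representative
    have hrx : setDist G w S (rep x) = setDist G w S x := by
      have h1 := setDist_le_add (w := w) hG (S := S) (x := rep x) (y := x)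
      have h2 := setDist_le_add (w := w) hG (S := S) (x := x) (y := rep x)
      rw [gdist_comm] at h2
      rw [h.rep_dist] at h1 h2
      linarith
    obtain ⟨y, z, hyz, hpar, hz, hw, he⟩ := h.par_spec S hS (rep x) (hrx ▸ h0)
    have hw' : (0 : ℝ) < w s(y, z) := by exact_mod_cast hw
    obtain ⟨F, hF⟩ := ih y (by linarith)
    refine ⟨insert s(y, z) F, ?_, ?_, fun K hTK hK => ?_⟩
    · intro e he'
      rcases Finset.mem_insert.1 he' with rfl | he'
      · exact ⟨rep x, h.rep_eq _ _ (h.rep_dist x), hrx ▸ h0, hrx.le, hpar.symm⟩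
      · obtain ⟨q, h1, h2, h3, h4⟩ := hF.mem e he'
        exact ⟨q, h1, h2, by linarith, h4⟩
    · have h1 : ∑ e ∈ insert s(y, z) F, w e ≤ w s(y, z) + ∑ e ∈ F, w e := by
        by_cases hm : s(y, z) ∈ F
        · rw [Finset.insert_eq_of_mem hm]; exact le_add_self
        · rw [Finset.sum_insert hm]
      have h2 : ((∑ e ∈ insert s(y, z) F, w e : ℝ≥0) : ℝ) ≤ w s(y, z) + (∑ e ∈ F, w e : ℝ≥0) := by
        exact_mod_cast h1
      have := hF.sum_le
      linarith
    · obtain ⟨s, hs, hsy⟩ := hF.reach K hTK fun e he => hK e (Finset.mem_insert_of_mem he)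
      refine ⟨s, hs, ?_⟩
      have hKc := hT.mono hTK
      have h1 := gdist_triangle (w := w) hKc (x := x) (y := z) (z := s)
      have h2 := gdist_triangle (w := w) hKc (x := z) (y := y) (z := s)
      have hKa : K.Adj z y := (hK _ (Finset.mem_insert_self _ _) : K.Adj y z).symm
      have h3 := gdist_le_of_adj (w := w) hKa
      rw [Sym2.eq_swap] at h3
      have h4 : gdist G w x z = 0 := by
        refine le_antisymm ?_ gdist_nonneg
        have h5 := gdist_triangle (w := w) hG (x := x) (y := rep x) (z := z)
        rw [gdist_comm (x := rep x), hz, gdist_comm (y := rep x), h.rep_dist] at h5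
        simpa using h5
      have h6 := gdist_anti (w := w) (x := x) (y := z) hT hTK
      rw [hzero _ _ h4] at h6
      linarith

end Routes

lemma sum_biUnion_le {ι α : Type*} [DecidableEq α] (s : Finset ι) (f : ι → Finset α) (g : α → ℝ≥0) :
    ∑ a ∈ s.biUnion f, g a ≤ ∑ i ∈ s, ∑ a ∈ f i, g a := by
  classical
  induction s using Finset.induction_on with
  | empty => simp
  | insert i s hi ih =>
    rw [Finset.biUnion_insert, Finset.sum_insert hi]
    refine le_trans ?_ (add_le_add_right ih _)
    rw [← Finset.sum_union_inter]
    exact le_self_add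

/-! ### The edges of one scale -/

section Scale

open scoped Classical

variable {V : Type*} {G T : SimpleGraph V} {w : Sym2 V → ℝ≥0} {θ X Λ : ℝ} {ρ : ℕ → ℝ}
  {P : ℕ → Finset V} {rep : V → V} {par : Finset V → V → Sym2 V}
  {route : Finset V → V → Finset (Sym2 V)} {k : ℕ}

/-- The edges that the spanner takes for one scale: on each level `i < k`, routes between an
unpopular center and the other centers within distance `ρ i`, and routes from the popular centers to
the centers of the next level. -/
noncomputable def scaleEdges (D : V → V → ℝ) (X : ℝ) (ρ : ℕ → ℝ) (P : ℕ → Finset V)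
    (route : Finset V → V → Finset (Sym2 V)) (k : ℕ) : Finset (Sym2 V) :=
  (Finset.range k).biUnion fun i =>
    ((P i \ popular D X (ρ i) (P i)).biUnion fun c =>
      ((P i).filter fun c' => D c c' ≤ ρ i).biUnion fun c' => route {c} c') ∪
    (popular D X (ρ i) (P i)).biUnion fun c => route (P (i + 1)) c

lemma mem_scaleEdges {D : V → V → ℝ} {e : Sym2 V} : e ∈ scaleEdges D X ρ P route k ↔
    ∃ i < k, (∃ c ∈ P i, c ∉ popular D X (ρ i) (P i) ∧ ∃ c' ∈ P i, D c c' ≤ ρ i ∧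
        e ∈ route {c} c') ∨
      ∃ c ∈ popular D X (ρ i) (P i), e ∈ route (P (i + 1)) c := by
  simp only [scaleEdges, Finset.mem_biUnion, Finset.mem_range, Finset.mem_union, Finset.mem_sdiff,
    Finset.mem_filter, and_assoc]

/-- At most `X` unpopular centers lie within distance `ρ` of any given point, since all of them lie
within distance `2 ρ` of each other. -/
lemma card_unpopular_near_le {D : V → V → ℝ} {ρ : ℝ} (hX : 0 ≤ X) (hsymm : ∀ x y, D x y = D y x)
    (htri : ∀ x y z, D x z ≤ D x y + D y z) (S : Finset V) (x : V) :
    (((S \ popular D X ρ S).filter fun c => D c x ≤ ρ).card : ℝ) ≤ X := by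
  rcases ((S \ popular D X ρ S).filter fun c => D c x ≤ ρ).eq_empty_or_nonempty with h | ⟨c, hc⟩
  · simpa [h] using hX
  · simp only [Finset.mem_filter, Finset.mem_sdiff, popular, not_and, not_lt] at hc
    refine le_trans ?_ (hc.1.2 hc.1.1)
    have : ((S \ popular D X ρ S).filter fun c => D c x ≤ ρ) ⊆ S.filter fun c' => D c c' ≤ 2 * ρ := by
      intro c' hc'
      simp only [Finset.mem_filter, Finset.mem_sdiff] at hc' ⊢
      have := htri c x c'
      have := hsymm x c'
      exact ⟨hc'.1.1, by linarith [hc'.2]⟩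
    exact_mod_cast Finset.card_le_card this

lemma card_near_unpopular_le {D : V → V → ℝ} {ρ : ℝ} (hρ : 0 ≤ ρ) {S : Finset V} {c : V}
    (hc : c ∈ S \ popular D X ρ S) : ((S.filter fun c' => D c c' ≤ ρ).card : ℝ) ≤ X := by
  simp only [Finset.mem_filter, Finset.mem_sdiff, popular, not_and, not_lt] at hc
  refine le_trans ?_ (hc.2 hc.1)
  have : (S.filter fun c' => D c c' ≤ ρ) ⊆ S.filter fun c' => D c c' ≤ 2 * ρ :=
    Finset.monotone_filter_right _ fun c' _ h => h.trans (by linarith)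
  exact_mod_cast Finset.card_le_card this

lemma IsHierarchy.setDist_le_of_popular (hP : IsHierarchy (gdist G (roundWeight w θ)) X ρ P)
    {i : ℕ} {c : V} (hc : c ∈ popular (gdist G (roundWeight w θ)) X (ρ i) (P i)) :
    (P (i + 1)).Nonempty ∧ setDist G (roundWeight w θ) (P (i + 1)) c ≤ 4 * ρ i := by
  obtain ⟨y, hy, h⟩ := hP.cover i c hc
  exact ⟨⟨y, hy⟩, (setDist_le hy).trans h⟩

lemma IsParentSystem.mem_edgeSet (hps : IsParentSystem G (roundWeight w θ) rep par)
    {S : Finset V} (hS : S.Nonempty) {x : V} {F : Finset (Sym2 V)}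
    (hF : IsRoute G T (roundWeight w θ) rep par S x F) {e : Sym2 V} (he : e ∈ F) :
    e ∈ G.edgeSet ∧ (w e : ℝ) ≤ setDist G (roundWeight w θ) S x ∧
      roundWeight w θ e = w e := by
  obtain ⟨q, hq, h0, hle, rfl⟩ := hF.mem e he
  obtain ⟨y, z, hyz, hpar, hz, hw, hs⟩ := hps.par_spec S hS q h0
  have h2 := (lt_of_roundWeight_pos hw).2
  rw [hpar]
  refine ⟨hyz, ?_, h2⟩
  rw [← h2]
  have := setDist_nonneg (G := G) (w := roundWeight w θ) (S := S) (x := y)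
  linarith

/-- The representatives of the classes that are entered by an edge of weight at most `Λ` from
another class. -/
noncomputable def activeReps [Fintype V] (G : SimpleGraph V) (w : Sym2 V → ℝ≥0) (θ : ℝ)
    (rep : V → V) (Λ : ℝ) : Finset V :=
  Finset.univ.filter fun q => rep q = q ∧ ∃ y z, G.Adj y z ∧ gdist G (roundWeight w θ) z q = 0 ∧
    gdist G (roundWeight w θ) y q ≠ 0 ∧ w s(y, z) ≤ Λ

/-- Each active class is left by an edge of the minimum spanning tree whose weight is in `(θ, Λ]`:
the tree path between the ends of an edge entering the class has to leave the class. -/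
lemma card_activeReps_le [Fintype V] (hT : IsMST G w T) (hθ : 0 ≤ θ)
    (hps : IsParentSystem G (roundWeight w θ) rep par) :
    (activeReps G w θ rep Λ).card ≤
      2 * (T.edgeFinset.filter fun e => θ < w e ∧ w e ≤ Λ).card := by
  set A := T.edgeFinset.filter fun e => θ < w e ∧ w e ≤ Λ
  have hG := hT.isTree.connected.mono hT.le
  have leave : ∀ {q a b : V} (p : T.Walk a b), gdist G (roundWeight w θ) a q = 0 →
      gdist G (roundWeight w θ) b q ≠ 0 → ∃ a' b', s(a', b') ∈ p.edges ∧
        gdist G (roundWeight w θ) a' q = 0 ∧ gdist G (roundWeight w θ) b' q ≠ 0 := by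
    intro q a b p h1 h2
    induction p with
    | nil => exact absurd h1 h2
    | @cons a b c hab p ih =>
      by_cases h : gdist G (roundWeight w θ) b q = 0
      · obtain ⟨a', b', h3, h4⟩ := ih h h2
        exact ⟨a', b', by simp [h3], h4⟩
      · exact ⟨a, b, by simp, h1, h⟩
  have hsub : activeReps G w θ rep Λ ⊆ A.biUnion fun e => e.toFinset.image rep := by
    intro q hq
    simp only [activeReps, Finset.mem_filter, Finset.mem_univ, true_and] at hq
    obtain ⟨hq, y, z, hyz, hz, hy, hw⟩ := hq
    obtain ⟨p, -, hp⟩ := hT.exists_path hyz.symm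
    obtain ⟨a, b, hab, ha, hb⟩ := leave p hz hy
    have hT' : T.Adj a b := p.edges_subset_edgeSet hab
    have h1 : θ < w s(a, b) := by
      by_contra! hle
      have h2 := gdist_le_of_adj (w := roundWeight w θ) (hT.le hT')
      rw [(roundWeight_eq_zero_iff hθ).2 hle, NNReal.coe_zero] at h2
      have h3 := gdist_triangle (w := roundWeight w θ) hG (x := b) (y := a) (z := q)
      rw [gdist_comm (x := b) (y := a)] at h3
      exact hb (le_antisymm (by linarith) gdist_nonneg)
    have h2 : (w s(a, b) : ℝ) ≤ Λ := by
      have := hp _ hab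
      rw [Sym2.eq_swap (a := z)] at this
      exact le_trans (by exact_mod_cast this) hw
    refine Finset.mem_biUnion.2 ⟨s(a, b), ?_, Finset.mem_image.2 ⟨a, by simp, ?_⟩⟩
    · simp [A, hT', h1, h2]
    · rw [hps.rep_eq _ _ ha, hq]
  refine (Finset.card_le_card hsub).trans ?_
  rw [mul_comm]
  refine Finset.card_biUnion_le_card_mul _ _ _ fun e _ => Finset.card_image_le.trans ?_
  rw [Sym2.card_toFinset]
  split_ifs <;> omega



/-- A route of length at most `Λ` consists of parent edges of active classes. -/
lemma IsParentSystem.exists_active [Fintype V] (hG : G.Connected)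
    (hps : IsParentSystem G (roundWeight w θ) rep par)
    {S : Finset V} (hS : S.Nonempty) {x : V} {F : Finset (Sym2 V)}
    (hF : IsRoute G T (roundWeight w θ) rep par S x F)
    (hx : setDist G (roundWeight w θ) S x ≤ Λ) {e : Sym2 V} (he : e ∈ F) :
    ∃ q ∈ activeReps G w θ rep Λ, setDist G (roundWeight w θ) S q ≤
      setDist G (roundWeight w θ) S x ∧ e = par S q := by
  have hle' := (hps.mem_edgeSet hS hF he).2.1
  obtain ⟨q, hq, h0, hle, rfl⟩ := hF.mem e he
  obtain ⟨y, z, hyz, hpar, hz, hw, hs⟩ := hps.par_spec S hS q h0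
  refine ⟨q, ?_, hle, rfl⟩
  simp only [activeReps, Finset.mem_filter, Finset.mem_univ, true_and]
  refine ⟨hq, y, z, hyz, hz, fun h => ?_, ?_⟩
  · have h1 := setDist_le_add (w := roundWeight w θ) hG (S := S) (x := q) (y := y)
    rw [gdist_comm, h] at h1
    have : (0 : ℝ) < roundWeight w θ s(y, z) := by exact_mod_cast hw
    linarith
  · rw [← hpar]; exact hle'.trans hx



lemma edge_of_mem_scaleEdges (hP : IsHierarchy (gdist G (roundWeight w θ)) X ρ P)
    (hps : IsParentSystem G (roundWeight w θ) rep par)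
    (hroute : ∀ S : Finset V, S.Nonempty → ∀ x,
      IsRoute G T (roundWeight w θ) rep par S x (route S x))
    (hρ : ∀ i, 0 ≤ ρ i) (hΛ : ∀ i < k, 4 * ρ i ≤ Λ) {e : Sym2 V}
    (he : e ∈ scaleEdges (gdist G (roundWeight w θ)) X ρ P route k) :
    e ∈ G.edgeSet ∧ (w e : ℝ) ≤ Λ := by
  obtain ⟨i, hi, ⟨c, -, -, c', -, hcc', he⟩ | ⟨c, hc, he⟩⟩ := mem_scaleEdges.1 he
  · have h1 := hps.mem_edgeSet (Finset.singleton_nonempty c)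
      (hroute _ (Finset.singleton_nonempty c) c') he
    rw [setDist_singleton, gdist_comm] at h1
    have := hρ i
    have := hΛ i hi
    exact ⟨h1.1, by linarith [h1.2.1]⟩
  · obtain ⟨hne, hle⟩ := hP.setDist_le_of_popular hc
    have h1 := hps.mem_edgeSet hne (hroute _ hne c) he
    exact ⟨h1.1, h1.2.1.trans (hle.trans (hΛ i hi))⟩

/-- The number of edges of one scale, in terms of the tree edges that are relevant to the scale.
A class is reached by routes to at most `X` unpopular centers of each level, and its parent edge for
each of them is counted once. -/
lemma card_scaleEdges_le [Fintype V] (hT : IsMST G w T) (hθ : 0 ≤ θ)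
    (hP : IsHierarchy (gdist G (roundWeight w θ)) X ρ P)
    (hps : IsParentSystem G (roundWeight w θ) rep par)
    (hroute : ∀ S : Finset V, S.Nonempty → ∀ x,
      IsRoute G T (roundWeight w θ) rep par S x (route S x))
    (hX : 0 ≤ X) (hρ : ∀ i, 0 ≤ ρ i) (hΛ : ∀ i < k, 4 * ρ i ≤ Λ) :
    ((scaleEdges (gdist G (roundWeight w θ)) X ρ P route k).card : ℝ) ≤
      2 * k * (X + 1) * (T.edgeFinset.filter fun e => θ < w e ∧ w e ≤ Λ).card := by
  have hG := hT.isTree.connected.mono hT.le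
  set D := gdist G (roundWeight w θ) with hD
  set A := activeReps G w θ rep Λ with hA
  have hsub : scaleEdges D X ρ P route k ⊆ (Finset.range k).biUnion fun i =>
      (A.biUnion fun q => ((P i \ popular D X (ρ i) (P i)).filter fun c => D c q ≤ ρ i).image
        fun c => par {c} q) ∪ A.image (par (P (i + 1))) := by
    intro e he
    obtain ⟨i, hi, h⟩ := mem_scaleEdges.1 he
    refine Finset.mem_biUnion.2 ⟨i, Finset.mem_range.2 hi, Finset.mem_union.2 ?_⟩
    rcases h with ⟨c, hc, hc2, c', -, hcc', he⟩ | ⟨c, hc, he⟩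
    · left
      have h0 : setDist G (roundWeight w θ) {c} c' ≤ ρ i := by
        rw [setDist_singleton, gdist_comm]; exact hcc'
      have h1 : setDist G (roundWeight w θ) {c} c' ≤ Λ := by
        have := hΛ i hi
        have := hρ i
        linarith
      obtain ⟨q, hq, hle, rfl⟩ := hps.exists_active hG (Finset.singleton_nonempty c)
        (hroute _ (Finset.singleton_nonempty c) c') h1 he
      refine Finset.mem_biUnion.2 ⟨q, hq, Finset.mem_image.2 ⟨c, ?_, rfl⟩⟩
      rw [setDist_singleton, gdist_comm] at hle
      exact Finset.mem_filter.2 ⟨Finset.mem_sdiff.2 ⟨hc, hc2⟩, hle.trans h0⟩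
    · right
      obtain ⟨hne, hle⟩ := hP.setDist_le_of_popular hc
      obtain ⟨q, hq, -, rfl⟩ := hps.exists_active hG hne (hroute _ hne c) (hle.trans (hΛ i hi)) he
      exact Finset.mem_image_of_mem _ hq
  have hcard : ((scaleEdges D X ρ P route k).card : ℝ) ≤ k * (A.card * X + A.card) := by
    calc ((scaleEdges D X ρ P route k).card : ℝ)
        ≤ ((∑ i ∈ Finset.range k, ((∑ q ∈ A,
            ((P i \ popular D X (ρ i) (P i)).filter fun c => D c q ≤ ρ i).card) + A.card) : ℕ) : ℝ) := by
          refine Nat.cast_le.2 ((Finset.card_le_card hsub).trans (Finset.card_biUnion_le.trans ?_))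
          refine Finset.sum_le_sum fun i _ => (Finset.card_union_le _ _).trans ?_
          refine add_le_add (Finset.card_biUnion_le.trans ?_) Finset.card_image_le
          exact Finset.sum_le_sum fun q _ => Finset.card_image_le
      _ ≤ ∑ i ∈ Finset.range k, (A.card * X + A.card) := by
          push_cast
          refine Finset.sum_le_sum fun i _ => add_le_add ?_ le_rfl
          rw [← nsmul_eq_mul, ← Finset.sum_const]
          exact Finset.sum_le_sum fun q _ => card_unpopular_near_le (D := D) hX
            (fun _ _ => gdist_comm) (fun _ _ _ => gdist_triangle hG) (P i) q
      _ = k * (A.card * X + A.card) := by simp; ring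
  have hAc : (A.card : ℝ) ≤ 2 * (T.edgeFinset.filter fun e => θ < w e ∧ w e ≤ Λ).card := by
    exact_mod_cast card_activeReps_le hT hθ hps
  have h2 := mul_le_mul_of_nonneg_left hAc (show 0 ≤ (k : ℝ) * (X + 1) by positivity)
  linarith

/-- The weight of one scale in terms of the numbers of centers. A level with a single center needs no
routes. -/
lemma sum_scaleEdges_le
    (hP : IsHierarchy (gdist G (roundWeight w θ)) X ρ P)
    (hps : IsParentSystem G (roundWeight w θ) rep par)
    (hroute : ∀ S : Finset V, S.Nonempty → ∀ x,
      IsRoute G T (roundWeight w θ) rep par S x (route S x))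
    (hX : 1 ≤ X) (hρ : ∀ i, 0 ≤ ρ i) {N : ℝ} (hN0 : 0 ≤ N)
    (hN : ∀ i < k, 1 < (P i).card → (P i).card * ρ i ≤ N) :
    ((∑ e ∈ scaleEdges (gdist G (roundWeight w θ)) X ρ P route k, w e : ℝ≥0) : ℝ) ≤
      k * ((X + 4) * N) := by
  set D := gdist G (roundWeight w θ) with hD
  have hsum : ∀ S : Finset V, S.Nonempty → ∀ x, ((∑ e ∈ route S x, w e : ℝ≥0) : ℝ) ≤
      setDist G (roundWeight w θ) S x := by
    intro S hS x
    rw [← Finset.sum_congr rfl fun e he => (hps.mem_edgeSet hS (hroute S hS x) he).2.2]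
    exact (hroute S hS x).sum_le
  have h1 : ∑ e ∈ scaleEdges D X ρ P route k, w e ≤ ∑ i ∈ Finset.range k,
      ((∑ c ∈ P i \ popular D X (ρ i) (P i), ∑ c' ∈ (P i).filter fun c' => D c c' ≤ ρ i,
        ∑ e ∈ route {c} c', w e) + ∑ c ∈ popular D X (ρ i) (P i), ∑ e ∈ route (P (i + 1)) c, w e) := by
    refine (sum_biUnion_le _ _ _).trans (Finset.sum_le_sum fun i _ => ?_)
    refine le_trans (by rw [← Finset.sum_union_inter]; exact le_self_add)
      (add_le_add ((sum_biUnion_le _ _ _).trans ?_) (sum_biUnion_le _ _ _))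
    exact Finset.sum_le_sum fun c _ => sum_biUnion_le _ _ _
  have h2 := NNReal.coe_le_coe.2 h1
  refine h2.trans ?_
  rw [NNReal.coe_sum]
  have h3 : ∀ i ∈ Finset.range k, (((∑ c ∈ P i \ popular D X (ρ i) (P i),
      ∑ c' ∈ (P i).filter fun c' => D c c' ≤ ρ i, ∑ e ∈ route {c} c', w e) +
      ∑ c ∈ popular D X (ρ i) (P i), ∑ e ∈ route (P (i + 1)) c, w e : ℝ≥0) : ℝ) ≤ (X + 4) * N := by
    intro i hi
    rw [NNReal.coe_add, NNReal.coe_sum, NNReal.coe_sum]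
    by_cases hc1 : 1 < (P i).card
    · have a1 : ∀ c ∈ P i \ popular D X (ρ i) (P i),
          ((∑ c' ∈ (P i).filter fun c' => D c c' ≤ ρ i, ∑ e ∈ route {c} c', w e : ℝ≥0) : ℝ) ≤
            X * ρ i := by
        intro c hc
        rw [NNReal.coe_sum]
        have : ∀ c' ∈ (P i).filter fun c' => D c c' ≤ ρ i,
            ((∑ e ∈ route {c} c', w e : ℝ≥0) : ℝ) ≤ ρ i := by
          intro c' hc'
          refine (hsum _ (Finset.singleton_nonempty c) c').trans ?_
          rw [setDist_singleton, gdist_comm]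
          exact (Finset.mem_filter.1 hc').2
        refine (Finset.sum_le_sum this).trans ?_
        rw [Finset.sum_const, nsmul_eq_mul]
        exact mul_le_mul_of_nonneg_right (card_near_unpopular_le (hρ i) hc) (hρ i)
      have a2 : ∀ c ∈ popular D X (ρ i) (P i),
          ((∑ e ∈ route (P (i + 1)) c, w e : ℝ≥0) : ℝ) ≤ 4 * ρ i := by
        intro c hc
        obtain ⟨hne, hle⟩ := hP.setDist_le_of_popular hc
        exact (hsum _ hne c).trans hle
      have a3 := add_le_add (Finset.sum_le_sum a1) (Finset.sum_le_sum a2)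
      refine a3.trans ?_
      rw [Finset.sum_const, Finset.sum_const, nsmul_eq_mul, nsmul_eq_mul]
      have b1 : ((P i \ popular D X (ρ i) (P i)).card : ℝ) ≤ (P i).card := by
        exact_mod_cast Finset.card_le_card Finset.sdiff_subset
      have b2 : ((popular D X (ρ i) (P i)).card : ℝ) ≤ (P i).card := by
        exact_mod_cast Finset.card_le_card (popular_subset _ _ _ _)
      have b3 := hN i (Finset.mem_range.1 hi) hc1
      have hXρ : 0 ≤ X * ρ i := mul_nonneg (by linarith) (hρ i)
      have b4 := mul_le_mul_of_nonneg_right b1 hXρ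
      have b5 := mul_le_mul_of_nonneg_right b2 (show 0 ≤ 4 * ρ i by linarith [hρ i])
      have b6 := mul_le_mul_of_nonneg_left b3 (show 0 ≤ X + 4 by linarith)
      linarith
    · have a1 : popular D X (ρ i) (P i) = ∅ := by
        refine Finset.eq_empty_of_forall_notMem fun c hc => hc1 ?_
        simp only [popular, Finset.mem_filter] at hc
        have : (1 : ℝ) < (P i).card := (hX.trans_lt hc.2).trans_le
          (by exact_mod_cast Finset.card_le_card (Finset.filter_subset _ _))
        exact_mod_cast this
      rw [a1, Finset.sum_empty, add_zero, Finset.sum_eq_zero]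
      · positivity
      · intro c hc
        rw [NNReal.coe_eq_zero]
        refine Finset.sum_eq_zero fun c' hc' => ?_
        obtain rfl : c' = c := Finset.card_le_one.1 (not_lt.1 hc1) _ (Finset.mem_filter.1 hc').1 _
          (Finset.mem_sdiff.1 hc).1
        rw [(hroute _ (Finset.singleton_nonempty c') c').eq_empty (by simp), Finset.sum_empty]
  refine (Finset.sum_le_sum h3).trans ?_
  simp

end Scale

/-! ### Stretch at one scale -/

section ScaleSpanner

open scoped Classical

variable {V : Type*} {G T K : SimpleGraph V} {w : Sym2 V → ℝ≥0} {θ X : ℝ} {ρ R : ℕ → ℝ}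
  {P : ℕ → Finset V} {rep : V → V} {par : Finset V → V → Sym2 V}
  {route : Finset V → V → Finset (Sym2 V)} {k : ℕ}

lemma sum_range_getVert (f : Sym2 V → ℝ≥0) {u v : V} (p : G.Walk u v) :
    ∑ j ∈ Finset.range p.length, f s(p.getVert j, p.getVert (j + 1)) = walkWeight f p := by
  induction p with
  | nil => simp
  | cons h p ih =>
    rw [SimpleGraph.Walk.length_cons, Finset.sum_range_succ', walkWeight_cons, ← ih, add_comm]
    simp

lemma getVert_mem_edges {u v : V} (p : G.Walk u v) {j : ℕ} (hj : j < p.length) :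
    s(p.getVert j, p.getVert (j + 1)) ∈ p.edges := by
  induction p generalizing j with
  | nil => simp at hj
  | cons h p ih =>
    cases j with
    | zero => simp
    | succ j =>
      simp only [SimpleGraph.Walk.getVert_cons_succ, SimpleGraph.Walk.edges_cons, List.mem_cons]
      exact Or.inr (ih (by simpa using hj))

variable [Finite V]

/-- Every vertex has a level `i < k` such that it is clustered, within radius `R i` in the spanner
`K`, around an unpopular center of level `i`, and also around a center of each lower level. -/
lemma exists_level (hT : T.Connected) (hTK : T ≤ K)
    (hP : IsHierarchy (gdist G (roundWeight w θ)) X ρ P)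
    (hroute : ∀ S : Finset V, S.Nonempty → ∀ x,
      IsRoute G T (roundWeight w θ) rep par S x (route S x))
    (hE : ∀ e ∈ scaleEdges (gdist G (roundWeight w θ)) X ρ P route (k + 1), e ∈ K.edgeSet)
    (hk : popular (gdist G (roundWeight w θ)) X (ρ k) (P k) = ∅)
    (hR : ∀ i, R i + 4 * ρ i ≤ R (i + 1)) {v : V}
    (h0 : ∃ c ∈ P 0, gdist K (roundWeight w θ) v c ≤ R 0) :
    ∃ l < k + 1, (∃ c ∈ P l \ popular (gdist G (roundWeight w θ)) X (ρ l) (P l),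
      gdist K (roundWeight w θ) v c ≤ R l) ∧
      ∀ i ≤ l, ∃ c ∈ P i, gdist K (roundWeight w θ) v c ≤ R i := by
  set D := gdist G (roundWeight w θ) with hD
  have hK := hT.mono hTK
  set U : ℕ → Prop := fun l => ∃ c ∈ P l \ popular D X (ρ l) (P l),
    gdist K (roundWeight w θ) v c ≤ R l with hU
  have step : ∀ i < k + 1, (∃ c ∈ P i, gdist K (roundWeight w θ) v c ≤ R i) → ¬ U i →
      ∃ c ∈ P (i + 1), gdist K (roundWeight w θ) v c ≤ R (i + 1) := by
    rintro i hi ⟨c, hc, hvc⟩ hUi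
    have hpop : c ∈ popular D X (ρ i) (P i) := by
      by_contra h
      exact hUi ⟨c, Finset.mem_sdiff.2 ⟨hc, h⟩, hvc⟩
    obtain ⟨hne, hle⟩ := hP.setDist_le_of_popular hpop
    obtain ⟨s, hs, hcs⟩ := (hroute _ hne c).reach K hTK fun e he =>
      hE e (mem_scaleEdges.2 ⟨i, hi, Or.inr ⟨c, hpop, he⟩⟩)
    refine ⟨s, hs, ?_⟩
    have := gdist_triangle (w := roundWeight w θ) hK (x := v) (y := c) (z := s)
    have := hR i
    linarith
  have up : ∀ l ≤ k, (∀ i < l, ¬ U i) → ∀ i ≤ l,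
      ∃ c ∈ P i, gdist K (roundWeight w θ) v c ≤ R i := by
    intro l hl hU i
    induction i with
    | zero => exact fun _ => h0
    | succ i ih => exact fun hi => step i (by omega) (ih (by omega)) (hU i (by omega))
  have hex : ∃ l, l < k + 1 ∧ U l := by
    by_contra! h
    obtain ⟨c, hc, hvc⟩ := up k le_rfl (fun i hi => h i (by omega)) k le_rfl
    exact h k (by omega) ⟨c, by rw [hk, Finset.sdiff_empty]; exact hc, hvc⟩
  obtain ⟨h1, h2⟩ := Nat.find_spec hex
  exact ⟨Nat.find hex, h1, h2, up _ (by omega) fun i hi h =>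
    Nat.find_min hex hi ⟨by omega, h⟩⟩

/-- Two clustered vertices near each other are joined in the spanner through their centers, with
additive error `4 R i`. -/
lemma gdist_le_of_centers (hG : G.Connected) (hT : T.Connected) (hTK : T ≤ K) (hKG : K ≤ G)
    (hroute : ∀ S : Finset V, S.Nonempty → ∀ x,
      IsRoute G T (roundWeight w θ) rep par S x (route S x))
    (hE : ∀ e ∈ scaleEdges (gdist G (roundWeight w θ)) X ρ P route k, e ∈ K.edgeSet)
    {i : ℕ} (hi : i < k) {r : ℝ} {u v c c' : V}
    (hc : c ∈ P i \ popular (gdist G (roundWeight w θ)) X (ρ i) (P i)) (hc' : c' ∈ P i)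
    (huc : gdist K (roundWeight w θ) u c ≤ r) (hvc : gdist K (roundWeight w θ) v c' ≤ r)
    {s : ℝ} (huv : gdist G (roundWeight w θ) u v ≤ s) (hs : s + 2 * r ≤ ρ i) :
    gdist K (roundWeight w θ) u v ≤ s + 4 * r := by
  have hK := hT.mono hTK
  have a1 := gdist_anti (w := roundWeight w θ) (x := u) (y := c) hK hKG
  have a2 := gdist_anti (w := roundWeight w θ) (x := v) (y := c') hK hKG
  have a3 := gdist_triangle (w := roundWeight w θ) hG (x := c) (y := u) (z := c')
  have a4 := gdist_triangle (w := roundWeight w θ) hG (x := u) (y := v) (z := c')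
  rw [gdist_comm (x := c) (y := u)] at a3
  have a5 : gdist G (roundWeight w θ) c c' ≤ ρ i := by linarith
  obtain ⟨x, hx, hle⟩ := (hroute {c} (Finset.singleton_nonempty c) c').reach K hTK fun e he =>
    hE e (mem_scaleEdges.2 ⟨i, hi, Or.inl ⟨c, (Finset.mem_sdiff.1 hc).1, (Finset.mem_sdiff.1 hc).2,
      c', hc', a5, he⟩⟩)
  rw [Finset.mem_singleton.1 hx, setDist_singleton, gdist_comm, gdist_comm (x := c')] at hle
  have b1 := gdist_triangle (w := roundWeight w θ) hK (x := u) (y := c) (z := v)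
  have b2 := gdist_triangle (w := roundWeight w θ) hK (x := c) (y := c') (z := v)
  rw [gdist_comm (x := c') (y := v)] at b2
  linarith

lemma gdist_getVert_le (hG : G.Connected) (f : Sym2 V → ℝ≥0) {u v : V} (p : G.Walk u v) {a b : ℕ}
    (hab : a ≤ b) (hb : b ≤ p.length) : gdist G f (p.getVert a) (p.getVert b) ≤
      (∑ j ∈ Finset.range b, (f s(p.getVert j, p.getVert (j + 1)) : ℝ)) -
      ∑ j ∈ Finset.range a, (f s(p.getVert j, p.getVert (j + 1)) : ℝ) := by
  induction b, hab using Nat.le_induction with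
  | base => simp
  | succ b hab ih =>
    have h1 := ih (by omega)
    have h2 := gdist_triangle (w := f) hG (x := p.getVert a) (y := p.getVert b)
      (z := p.getVert (b + 1))
    have h3 := gdist_le_of_adj (w := f) (p.adj_getVert_succ (show b < p.length by omega))
    rw [Finset.sum_range_succ]
    linarith

/-- The stretch achieved at scale `r` for paths with edges of weight at most `r`, in the rounded
weight. -/
lemma stretch_of_scaleEdges (hG : G.Connected) (hT : T.Connected) (hTK : T ≤ K) (hKG : K ≤ G)
    {r M ε : ℝ} (hr : 0 < r) (hε0 : 0 < ε) (hε1 : ε < 1) (hM : 200 * ((k + 1 : ℕ) : ℝ) ≤ ε * M)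
    (hP : IsHierarchy (gdist G (roundWeight w θ)) X (fun i => r * M ^ (i + 1)) P)
    (hroute : ∀ S : Finset V, S.Nonempty → ∀ x,
      IsRoute G T (roundWeight w θ) rep par S x (route S x))
    (hE : ∀ e ∈ scaleEdges (gdist G (roundWeight w θ)) X (fun i => r * M ^ (i + 1)) P route (k + 1),
      e ∈ K.edgeSet)
    (hk : popular (gdist G (roundWeight w θ)) X (r * M ^ (k + 1)) (P k) = ∅)
    (h0 : ∀ v, ∃ c ∈ P 0, gdist T w v c ≤ r) {u v : V} (p : G.Walk u v)
    (hp : ∀ e ∈ p.edges, (w e : ℝ) ≤ r) :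
    gdist K (roundWeight w θ) u v ≤ (1 + ε) * walkWeight w p + r * M ^ (k + 1) := by
  have hK := hT.mono hTK
  have hk1 : (1 : ℝ) ≤ ((k + 1 : ℕ) : ℝ) := by exact_mod_cast Nat.succ_le_succ (Nat.zero_le k)
  have hM200 : 200 ≤ M := by nlinarith
  have hpow : ∀ i, 0 < r * M ^ i := fun i => by positivity
  -- clusters of level `i` have radius `5 r M ^ i` in the spanner
  have hlevel : ∀ v, ∃ l < k + 1, (∃ c ∈ P l \ popular (gdist G (roundWeight w θ)) X
        (r * M ^ (l + 1)) (P l), gdist K (roundWeight w θ) v c ≤ 5 * (r * M ^ l)) ∧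
      ∀ i ≤ l, ∃ c ∈ P i, gdist K (roundWeight w θ) v c ≤ 5 * (r * M ^ i) := by
    intro v
    refine exists_level (R := fun i => 5 * (r * M ^ i)) hT hTK hP hroute hE hk (fun i => ?_) ?_
    · have := hpow i
      rw [pow_succ]
      nlinarith
    · obtain ⟨c, hc, hvc⟩ := h0 v
      refine ⟨c, hc, (gdist_anti hT hTK).trans ((gdist_mono_weight hT roundWeight_le).trans ?_)⟩
      simp only [pow_zero]
      linarith
  choose lev hlev hU hC using hlevel
  set η := ε / ((k + 1 : ℕ) : ℝ) with hη
  have hη0 : 0 ≤ η := by positivity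
  have hηM : 200 ≤ η * M := by
    rw [hη, div_mul_eq_mul_div, le_div_iff₀ (by positivity)]; exact hM
  have hη1 : η ≤ 1 := by
    rw [hη, div_le_one (by positivity)]; linarith
  set t : ℕ → ℝ := fun a =>
    ∑ j ∈ Finset.range a, (roundWeight w θ s(p.getVert j, p.getVert (j + 1)) : ℝ) with ht
  have htmono : Monotone t := fun a b hab =>
    Finset.sum_le_sum_of_subset_of_nonneg (by simpa using hab) fun _ _ _ => NNReal.coe_nonneg _
  -- a jump of level `i` is allowed up to distance `ρ i - 2 R i = r M ^ (i + 1) - 10 r M ^ i`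
  have hMi : ∀ i, r ≤ r * M ^ i := fun i =>
    le_mul_of_one_le_right hr.le (one_le_pow₀ (by linarith))
  have key := stretch_of_levels (d := fun a b => gdist K (roundWeight w θ) (p.getVert a)
      (p.getVert b)) (t := t) (lev := fun a => lev (p.getVert a)) (R := fun i => 5 * (r * M ^ i))
    (σ := fun i => r * M ^ (i + 1) - 10 * (r * M ^ i)) (B := fun i => r * M ^ i)
    (m := p.length) (k := k + 1) (η := η) (fun a b c => gdist_triangle hK) htmono hη0
    (fun i => by have := hpow i; linarith)
    (fun i j hij => by
      have : M ^ i ≤ M ^ j := pow_le_pow_right₀ (by linarith) hij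
      have := mul_le_mul_of_nonneg_left this hr.le
      dsimp only
      linarith)
    (fun i => (hpow i).le)
    (fun i => by
      have := hpow i
      rw [pow_succ]
      nlinarith)
    (fun i => by
      have h1 := hpow i
      have h2 : η * (r * M ^ (i + 1) - 10 * (r * M ^ i)) = (η * M - 10 * η) * (r * M ^ i) := by
        ring
      rw [h2]
      nlinarith)
    (fun i => by
      have := hpow i
      rw [pow_succ]
      nlinarith)
    (fun a b hab hb hs => by
      have hab' := gdist_getVert_le hG (roundWeight w θ) p hab hb
      rcases le_total (lev (p.getVert a)) (lev (p.getVert b)) with h | h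
      · rw [min_eq_left h] at hs ⊢
        obtain ⟨c, hc, hac⟩ := hU (p.getVert a)
        obtain ⟨c', hc', hbc⟩ := hC (p.getVert b) _ h
        exact gdist_le_of_centers hG hT hTK hKG hroute hE (hlev _) hc hc' hac hbc hab' (by linarith)
      · rw [min_eq_right h] at hs ⊢
        obtain ⟨c, hc, hbc⟩ := hU (p.getVert b)
        obtain ⟨c', hc', hac⟩ := hC (p.getVert a) _ h
        rw [gdist_comm] at hab' ⊢
        exact gdist_le_of_centers hG hT hTK hKG hroute hE (hlev _) hc hc' hbc hac hab' (by linarith))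
    (fun a ha i => by
      have h1 := hp _ (getVert_mem_edges p ha)
      have h2 : (roundWeight w θ s(p.getVert a, p.getVert (a + 1)) : ℝ) ≤
        w s(p.getVert a, p.getVert (a + 1)) := by exact_mod_cast roundWeight_le _
      have h3 := hpow i
      have h4 := hMi i
      simp only [ht, Finset.sum_range_succ, add_sub_cancel_left]
      rw [pow_succ]
      nlinarith)
    (fun a _ => hlev _)
  have hkη : ((k + 1 : ℕ) : ℝ) * η = ε := by rw [hη]; field_simp
  have htm : t p.length = walkWeight (roundWeight w θ) p := by
    rw [← sum_range_getVert, NNReal.coe_sum]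
  have ht0 : t 0 = 0 := by simp [ht]
  simp only [SimpleGraph.Walk.getVert_zero, SimpleGraph.Walk.getVert_length, hkη, htm, ht0,
    sub_zero] at key
  have hw : (walkWeight (roundWeight w θ) p : ℝ) ≤ walkWeight w p := by
    exact_mod_cast walkWeight_mono roundWeight_le p
  have := mul_le_mul_of_nonneg_left hw (show 0 ≤ 1 + ε by linarith)
  linarith

end ScaleSpanner

section

variable {V : Type*} [Fintype V] {G T : SimpleGraph V} {w : Sym2 V → ℝ≥0}

open scoped Classical in
/-- For each scale `r` there is a set of edges that, together with the minimum spanning tree, gives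
the required stretch to all paths with edges of weight at most `r`. -/
lemma IsMST.exists_scale (hT : IsMST G w T) {r M X ε : ℝ} {k : ℕ} (hr : 0 < r) (hε0 : 0 < ε)
    (hε1 : ε < 1) (hk : 1 ≤ k) (hM : 200 * (k : ℝ) ≤ ε * M) (hX : 1 ≤ X)
    (hn : (Fintype.card V : ℝ) ≤ X ^ k) :
    ∃ E : Finset (Sym2 V), (∀ e ∈ E, e ∈ G.edgeSet ∧ (w e : ℝ) ≤ 4 * (r * M ^ k)) ∧
      (E.card : ℝ) ≤ 2 * k * (X + 1) * (T.edgeFinset.filter fun e =>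
        r / Fintype.card V < w e ∧ w e ≤ 4 * (r * M ^ k)).card ∧
      ((∑ e ∈ E, w e : ℝ≥0) : ℝ) ≤ k * ((X + 4) * (2 * totalWeight w T * M)) ∧
      (totalWeight w T ≤ r → ((∑ e ∈ E, w e : ℝ≥0) : ℝ) ≤ 0) ∧
      ∀ K, T ≤ K → K ≤ G → (∀ e ∈ E, e ∈ K.edgeSet) → ∀ (u v : V) (p : G.Walk u v),
        (∀ e ∈ p.edges, (w e : ℝ) ≤ r) →
        gdist K w u v ≤ (1 + ε) * walkWeight w p + 2 * (r * M ^ k) := by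
  obtain ⟨k, rfl⟩ : ∃ l, k = l + 1 := ⟨k - 1, by omega⟩
  have hTc := hT.isTree.connected
  have hG := hTc.mono hT.le
  have : Nonempty V := hG.nonempty
  have hcard : (0 : ℝ) < Fintype.card V := by exact_mod_cast Fintype.card_pos
  have hk1 : (1 : ℝ) ≤ ((k + 1 : ℕ) : ℝ) := by exact_mod_cast hk
  have hM200 : 200 ≤ M := by nlinarith
  set θ := r / Fintype.card V with hθ
  have hθ0 : 0 ≤ θ := by positivity
  set ρ : ℕ → ℝ := fun i => r * M ^ (i + 1) with hρ
  have hρ0 : ∀ i, 0 ≤ ρ i := fun i => by positivity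
  obtain ⟨rep, par, hps⟩ := exists_isParentSystem hG (roundWeight w θ)
  have hr' : ∀ (S : Finset V) (x : V), ∃ F, S.Nonempty →
      IsRoute G T (roundWeight w θ) rep par S x F := by
    intro S x
    by_cases hS : S.Nonempty
    · obtain ⟨F, hF⟩ := hps.exists_isRoute hG hTc
        (fun x y h => hT.gdist_roundWeight_eq_zero hθ0 h) hS x
      exact ⟨F, fun _ => hF⟩
    · exact ⟨∅, fun h => absurd h hS⟩
  choose route hroute' using hr'
  have hroute : ∀ S : Finset V, S.Nonempty → ∀ x,
    IsRoute G T (roundWeight w θ) rep par S x (route S x) := fun S hS x => hroute' S x hS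
  obtain ⟨P₀, -, hsep, hcov⟩ := exists_net (D := gdist T w) (s := r) (fun x => by simp [hr.le])
    (fun _ _ => gdist_comm) Finset.univ
  obtain ⟨P, hP0, hP⟩ := exists_isHierarchy (D := gdist G (roundWeight w θ)) (fun _ => gdist_self)
    (fun _ _ => gdist_comm) X hρ0 P₀
  have hDT : ∀ x y, gdist G (roundWeight w θ) x y ≤ gdist T w x y := fun x y =>
    (gdist_anti hTc hT.le).trans (gdist_mono_weight hTc roundWeight_le)
  have hΛ : ∀ i < k + 1, 4 * ρ i ≤ 4 * (r * M ^ (k + 1)) := fun i hi => by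
    have : M ^ (i + 1) ≤ M ^ (k + 1) := pow_le_pow_right₀ (by linarith) (by omega)
    have := mul_le_mul_of_nonneg_left this hr.le
    simp only [hρ]
    linarith
  have hpop := hP.popular_eq_empty (fun _ _ => gdist_comm) (fun _ _ _ => gdist_triangle hG) hX hn
  refine ⟨scaleEdges (gdist G (roundWeight w θ)) X ρ P route (k + 1),
    fun e he => edge_of_mem_scaleEdges hP hps hroute hρ0 hΛ he,
    card_scaleEdges_le hT hθ0 hP hps hroute (by linarith) hρ0 hΛ, ?_, ?_, ?_⟩
  · refine sum_scaleEdges_le hP hps hroute hX hρ0 (by positivity) fun i _ hi => ?_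
    cases i with
    | zero =>
      have h1 := card_mul_le_of_separated hTc hr.le (hP0 ▸ hsep) hi
      have h2 := mul_le_mul_of_nonneg_right h1 (show 0 ≤ M by linarith)
      simp only [hρ, zero_add, pow_one]
      linarith
    | succ i =>
      have h1 := card_mul_le_of_separated hTc (s := 4 * ρ i) (by linarith [hρ0 i])
        (fun x hx y hy hxy => (hP.separated i x hx y hy hxy).trans_le (hDT x y)) hi
      have h2 := mul_le_mul_of_nonneg_right h1 (show 0 ≤ M by linarith)
      have h3 : ρ (i + 1) = ρ i * M := by simp only [hρ]; ring
      have h4 : 0 ≤ (P (i + 1)).card * (ρ i * M) :=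
        mul_nonneg (Nat.cast_nonneg _) (mul_nonneg (hρ0 i) (by linarith))
      rw [h3]
      linarith
  · intro hL
    refine (sum_scaleEdges_le (N := 0) hP hps hroute hX hρ0 le_rfl fun i _ hi => ?_).trans (by simp)
    have hsub : ∀ i, P i ⊆ P₀ := by
      intro i
      induction i with
      | zero => rw [hP0]
      | succ i ih => exact (hP.subset i).trans ((popular_subset _ _ _ _).trans ih)
    obtain ⟨x, hx, y, hy, hxy⟩ := Finset.one_lt_card.1 (hi.trans_le (Finset.card_le_card (hsub i)))
    have := hsep x hx y hy hxy
    have := gdist_le_totalWeight hTc w x y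
    linarith
  · intro K hTK hKG hE u v p hp
    have hcov' : ∀ v, ∃ c ∈ P 0, gdist T w v c ≤ r := fun v =>
      hP0 ▸ hcov v (Finset.mem_univ v)
    have h1 := stretch_of_scaleEdges hG hTc hTK hKG hr hε0 hε1 hM hP hroute hE hpop hcov' p hp
    have h2 := gdist_le_gdist_add (w := w) (w' := roundWeight w θ) (hTc.mono hTK) hθ0
      (fun e _ => le_roundWeight_add hθ0 e) (x := u) (y := v)
    have h3 : (Fintype.card V : ℝ) * θ = r := by rw [hθ]; field_simp
    have h4 : r ≤ r * M ^ (k + 1) := le_mul_of_one_le_right hr.le (one_le_pow₀ (by linarith))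
    linarith

end

/-! ### Counting dyadic scales -/

section Counting

/-- Dyadic scales in an interval. -/
lemma card_le_of_zpow_mem {J : Finset ℤ} {a b : ℝ} (ha : 0 < a) (hab : a ≤ b)
    (hJ : ∀ j ∈ J, a ≤ (2 : ℝ) ^ j ∧ (2 : ℝ) ^ j ≤ b) : (J.card : ℝ) ≤ Real.logb 2 (b / a) + 1 := by
  have hb : 0 < b := ha.trans_le hab
  have hsub : J ⊆ Finset.Icc ⌈Real.logb 2 a⌉ ⌊Real.logb 2 b⌋ := by
    intro j hj
    obtain ⟨h1, h2⟩ := hJ j hj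
    have e : Real.logb 2 ((2 : ℝ) ^ j) = j := by
      rw [← Real.rpow_intCast, Real.logb_rpow (by norm_num) (by norm_num)]
    rw [Finset.mem_Icc, Int.ceil_le, Int.le_floor, ← e]
    exact ⟨Real.logb_le_logb_of_le (by norm_num) ha h1,
      Real.logb_le_logb_of_le (by norm_num) (by positivity) h2⟩
  have h1 : (J.card : ℤ) ≤ ⌊Real.logb 2 b⌋ + 1 - ⌈Real.logb 2 a⌉ ∨ J.card = 0 := by
    have := Finset.card_le_card hsub
    rw [Int.card_Icc] at this
    omega
  have hl : Real.logb 2 (b / a) = Real.logb 2 b - Real.logb 2 a := Real.logb_div hb.ne' ha.ne'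
  have hl0 : Real.logb 2 a ≤ Real.logb 2 b := Real.logb_le_logb_of_le (by norm_num) ha hab
  rcases h1 with h1 | h1
  · have h2 : (J.card : ℝ) ≤ ⌊Real.logb 2 b⌋ + 1 - ⌈Real.logb 2 a⌉ := by exact_mod_cast h1
    have := Int.floor_le (Real.logb 2 b)
    have := Int.le_ceil (Real.logb 2 a)
    linarith
  · rw [h1, Nat.cast_zero]; linarith

lemma logb_four_mul_pow_add_one_le {n : ℝ} (hn : 3 ≤ n) (m : ℕ) :
    Real.logb 2 (4 * n ^ m) + 1 ≤ (3 + 2 * m) * Real.log n := by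
  have h1 : 1 ≤ Real.log n := by
    rw [Real.le_log_iff_exp_le (by linarith)]
    exact (Real.exp_one_lt_d9.le.trans (by norm_num)).trans hn
  have h2 : Real.logb 2 (4 * n ^ m) = 2 + m * Real.logb 2 n := by
    rw [Real.logb_mul (by norm_num) (by positivity), Real.logb_pow,
      show (4 : ℝ) = 2 ^ (2 : ℕ) by norm_num, Real.logb_pow, Real.logb_self_eq_one (by norm_num)]
    norm_num
  have h3 : Real.logb 2 n ≤ 2 * Real.log n := by
    rw [Real.logb, div_le_iff₀ (Real.log_pos (by norm_num))]
    have := Real.log_two_gt_d9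
    nlinarith
  have h4 := mul_le_mul_of_nonneg_left h3 (Nat.cast_nonneg (α := ℝ) m)
  rw [h2]
  linarith

end Counting

/-! ### The union of all scales -/

section Assembly

open scoped Classical

variable {V : Type*} {G T H : SimpleGraph V} {w : Sym2 V → ℝ≥0}

/-- The dyadic scales of the positive edge weights. -/
noncomputable def scales [Fintype V] (G : SimpleGraph V) (w : Sym2 V → ℝ≥0) : Finset ℤ :=
  (G.edgeFinset.filter fun e => 0 < w e).image fun e => Int.clog 2 (w e : ℝ)

lemma exists_mem_edges_eq_heaviestEdge {u v : V} (p : G.Walk u v) (h : 0 < heaviestEdge w p) :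
    ∃ e ∈ p.edges, w e = heaviestEdge w p := by
  unfold heaviestEdge at h ⊢
  generalize p.edges = l at h ⊢
  induction l with
  | nil => simp at h
  | cons a l ih =>
    simp only [List.map_cons, List.foldr_cons] at h ⊢
    rcases max_choice (w a) ((l.map w).foldr max 0) with h' | h'
    · exact ⟨a, by simp, h'.symm⟩
    · rw [h'] at h ⊢
      obtain ⟨e, he, hw⟩ := ih h
      exact ⟨e, by simp [he], hw⟩

lemma exists_scale_of_pos [Fintype V] {u v : V} (p : G.Walk u v) (h : 0 < heaviestEdge w p) :
    ∃ j ∈ scales G w, (heaviestEdge w p : ℝ) ≤ 2 ^ j ∧ (2 : ℝ) ^ j ≤ 2 * heaviestEdge w p := by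
  obtain ⟨e, he, hw⟩ := exists_mem_edges_eq_heaviestEdge p h
  have h' : (0 : ℝ) < heaviestEdge w p := by exact_mod_cast h
  refine ⟨Int.clog 2 (w e : ℝ), Finset.mem_image.2 ⟨e, ?_, rfl⟩, ?_, ?_⟩
  · simp only [Finset.mem_filter, SimpleGraph.mem_edgeFinset]
    exact ⟨p.edges_subset_edgeSet he, hw ▸ h⟩
  · rw [hw]
    exact_mod_cast Int.self_le_zpow_clog (b := 2) (by norm_num) (heaviestEdge w p : ℝ)
  · rw [hw]
    have := Int.zpow_pred_clog_lt_self (b := 2) (by norm_num) h'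
    rw [zpow_sub_one₀ (by norm_num)] at this
    push_cast at this
    linarith

variable [Fintype V]

/-- A real-valued stretch bound for shortest paths gives a spanner. -/
lemma isSpanner_of_gdist_le (hH : H.Connected) (hHG : H ≤ G) {ε β : ℝ} (hε : 0 ≤ ε) (hβ : 0 ≤ β)
    (h : ∀ (u v : V) (p : G.Walk u v),
      gdist H w u v ≤ (1 + ε) * walkWeight w p + β * heaviestEdge w p)
    (W : V → V → ℝ≥0) (hW : IsLocalMaxWeight G w W) :
    IsSpanner G w H (ENNReal.ofReal (1 + ε)) (fun u v => ENNReal.ofReal β * (W u v : ℝ≥0∞)) := by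
  refine ⟨hHG, fun u v => ?_⟩
  have hG := hH.mono hHG
  obtain ⟨p, hp, hWp⟩ := hW u v
  rw [← ofReal_gdist hG, ← ofReal_gdist hH]
  refine ⟨ENNReal.ofReal_le_ofReal (gdist_anti hH hHG), ?_⟩
  have hpd : (walkWeight w p : ℝ) = gdist G w u v := by
    rw [gdist, ← hp.2, ENNReal.coe_toReal]
  dsimp only
  rw [hWp, ← ENNReal.ofReal_coe_nnreal, ← ENNReal.ofReal_mul (by linarith),
    ← ENNReal.ofReal_mul hβ, ← ENNReal.ofReal_add
      (mul_nonneg (by linarith) gdist_nonneg) (mul_nonneg hβ (NNReal.coe_nonneg _)), ← hpd]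
  exact ENNReal.ofReal_le_ofReal (h u v p)

/-- In a minimum spanning tree all distances are at most `n` times the heaviest edge of any path of
the graph. -/
lemma IsMST.gdist_le_card_mul_heaviestEdge (hT : IsMST G w T) {u v : V} (p : G.Walk u v) :
    gdist T w u v ≤ Fintype.card V * heaviestEdge w p := by
  have key : ∀ {a b : V} (q : G.Walk a b), ∃ q' : T.Walk a b, ∀ e ∈ q'.edges, ∃ e' ∈ q.edges,
      w e ≤ w e' := by
    intro a b q
    induction q with
    | nil => exact ⟨.nil, by simp⟩
    | @cons a b c hab q ih =>
      obtain ⟨q1, h1⟩ := ih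
      obtain ⟨q2, -, h2⟩ := hT.exists_path hab
      refine ⟨q2.append q1, fun e he => ?_⟩
      rw [SimpleGraph.Walk.edges_append, List.mem_append] at he
      rcases he with he | he
      · exact ⟨s(a, b), by simp, h2 e he⟩
      · obtain ⟨e', he', hle⟩ := h1 e he
        exact ⟨e', by simp [he'], hle⟩
  obtain ⟨q, hq⟩ := key p
  refine gdist_le_card_mul q.bypass q.bypass_isPath (NNReal.coe_nonneg _) fun e he => ?_
  obtain ⟨e', he', hle⟩ := hq e (q.edges_bypass_subset_edges he)
  exact_mod_cast hle.trans (le_heaviestEdge he')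

/-- The number of edges of the union of all scales: a tree edge is relevant to `O(log n)` scales. -/
lemma card_biUnion_scales_le (hT : T.IsTree) {J : Finset ℤ} {E : ℤ → Finset (Sym2 V)} {N A : ℝ}
    (hn : 3 ≤ (Fintype.card V : ℝ)) (hA : 0 ≤ A) (hN : N ≤ Fintype.card V)
    (hE : ∀ j ∈ J, ((E j).card : ℝ) ≤ A * (T.edgeFinset.filter fun e =>
      (2 : ℝ) ^ j / Fintype.card V < w e ∧ w e ≤ 4 * ((2 : ℝ) ^ j * N)).card) :
    ((J.biUnion E).card : ℝ) ≤ A * (Fintype.card V * (7 * Real.log (Fintype.card V))) := by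
  set n : ℝ := (Fintype.card V : ℝ) with hn'
  have h1 : ((J.biUnion E).card : ℝ) ≤ ∑ j ∈ J, ((E j).card : ℝ) := by
    exact_mod_cast Finset.card_biUnion_le
  refine (h1.trans (Finset.sum_le_sum hE)).trans ?_
  rw [← Finset.mul_sum]
  refine mul_le_mul_of_nonneg_left ?_ hA
  have h2 : ∑ j ∈ J, ((T.edgeFinset.filter fun e =>
      (2 : ℝ) ^ j / n < w e ∧ w e ≤ 4 * ((2 : ℝ) ^ j * N)).card : ℝ) =
      ∑ e ∈ T.edgeFinset, ((J.filter fun j : ℤ =>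
        (2 : ℝ) ^ j / n < w e ∧ w e ≤ 4 * ((2 : ℝ) ^ j * N)).card : ℝ) := by
    simp only [Finset.card_filter, Nat.cast_sum]
    exact Finset.sum_comm
  rw [h2]
  have h3 : ∀ e ∈ T.edgeFinset, ((J.filter fun j : ℤ =>
      (2 : ℝ) ^ j / n < w e ∧ w e ≤ 4 * ((2 : ℝ) ^ j * N)).card : ℝ) ≤ 7 * Real.log n := by
    intro e _
    rcases (w e).2.eq_or_lt with h0 | h0
    · have h0' : ((w e : ℝ≥0) : ℝ) = 0 := h0.symm
      rw [Finset.filter_eq_empty_iff.2, Finset.card_empty, Nat.cast_zero]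
      · have := Real.log_nonneg (show 1 ≤ n by linarith)
        linarith
      · rintro j - ⟨h, -⟩
        rw [h0'] at h
        have : (0 : ℝ) < 2 ^ j / n := by positivity
        linarith
    · have h0' : (0 : ℝ) < w e := h0
      have hab : (w e : ℝ) / (4 * n) ≤ w e * n := by
        rw [div_le_iff₀ (by positivity), mul_assoc]
        exact le_mul_of_one_le_right h0'.le (by nlinarith)
      refine (card_le_of_zpow_mem (a := w e / (4 * n)) (b := w e * n) (by positivity) hab ?_).trans
        ?_
      · intro j hj
        obtain ⟨-, hj1, hj2⟩ := Finset.mem_filter.1 hj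
        have hj0 : (0 : ℝ) < 2 ^ j := by positivity
        constructor
        · rw [div_le_iff₀ (by positivity)]
          have := mul_le_mul_of_nonneg_left hN hj0.le
          linarith
        · rw [div_lt_iff₀ (by positivity)] at hj1
          exact hj1.le
      · have h4 : w e * n / (w e / (4 * n)) = 4 * n ^ 2 := by
          field_simp
        rw [h4]
        have := logb_four_mul_pow_add_one_le hn 2
        norm_num at this
        exact this
  refine (Finset.sum_le_sum h3).trans ?_
  rw [Finset.sum_const, nsmul_eq_mul]
  have h4 : ((T.edgeFinset.card : ℕ) : ℝ) ≤ n := by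
    have := hT.card_edgeFinset
    rw [hn']
    exact_mod_cast (show T.edgeFinset.card ≤ Fintype.card V by omega)
  exact mul_le_mul_of_nonneg_right h4
    (by have := Real.log_nonneg (show 1 ≤ n by linarith); linarith)

/-- The weight of the union of all scales. Edges of weight at most `L / n²` weigh at most `L`
altogether; heavier ones come from the `O(log n)` scales between `L / (4 n³)` and `L`. -/
lemma sum_biUnion_scales_le {J : Finset ℤ} {E : ℤ → Finset (Sym2 V)} {L N A : ℝ}
    (hn : 3 ≤ (Fintype.card V : ℝ)) (hL : 0 ≤ L) (hA : 0 ≤ A) (hN : N ≤ Fintype.card V)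
    (hE : ∀ j ∈ J, ∀ e ∈ E j, e ∈ G.edgeSet ∧ (w e : ℝ) ≤ 4 * ((2 : ℝ) ^ j * N))
    (hsum : ∀ j ∈ J, ((∑ e ∈ E j, w e : ℝ≥0) : ℝ) ≤ A)
    (hsum0 : ∀ j ∈ J, L ≤ (2 : ℝ) ^ j → ((∑ e ∈ E j, w e : ℝ≥0) : ℝ) ≤ 0) :
    ((∑ e ∈ J.biUnion E, w e : ℝ≥0) : ℝ) ≤ L + 9 * Real.log (Fintype.card V) * A := by
  set n : ℝ := (Fintype.card V : ℝ) with hn'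
  have hlog := Real.log_nonneg (show 1 ≤ n by linarith)
  set B := J.biUnion E with hB
  rw [NNReal.coe_sum, ← Finset.sum_filter_add_sum_filter_not B fun e => (w e : ℝ) ≤ L / n ^ 2]
  refine add_le_add ?_ ?_
  · have h1 : ∑ e ∈ B.filter (fun e => (w e : ℝ) ≤ L / n ^ 2), (w e : ℝ) ≤
        (B.filter (fun e => (w e : ℝ) ≤ L / n ^ 2)).card • (L / n ^ 2) :=
      Finset.sum_le_card_nsmul _ _ _ fun e he => (Finset.mem_filter.1 he).2
    refine h1.trans ?_
    have h2 : B.filter (fun e => (w e : ℝ) ≤ L / n ^ 2) ⊆ G.edgeFinset := by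
      intro e he
      obtain ⟨j, hj, hej⟩ := Finset.mem_biUnion.1 (Finset.mem_filter.1 he).1
      simpa using (hE j hj e hej).1
    have h3 : (B.filter (fun e => (w e : ℝ) ≤ L / n ^ 2)).card ≤ Fintype.card V ^ 2 := by
      refine (Finset.card_le_card h2).trans (SimpleGraph.card_edgeFinset_le_card_choose_two.trans ?_)
      exact Nat.choose_le_pow _ _
    have h4 : ((B.filter (fun e => (w e : ℝ) ≤ L / n ^ 2)).card : ℝ) ≤ n ^ 2 := by
      refine (Nat.cast_le.2 h3).trans (le_of_eq ?_)
      rw [Nat.cast_pow]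
    rw [nsmul_eq_mul]
    calc _ ≤ n ^ 2 * (L / n ^ 2) := mul_le_mul_of_nonneg_right h4 (by positivity)
      _ = L := by field_simp
  · set J' := J.filter fun j : ℤ => L / (4 * n ^ 3) ≤ (2 : ℝ) ^ j with hJ'
    have hsub : B.filter (fun e => ¬ (w e : ℝ) ≤ L / n ^ 2) ⊆ J'.biUnion E := by
      intro e he
      obtain ⟨he1, he2⟩ := Finset.mem_filter.1 he
      obtain ⟨j, hj, hej⟩ := Finset.mem_biUnion.1 he1
      refine Finset.mem_biUnion.2 ⟨j, Finset.mem_filter.2 ⟨hj, ?_⟩, hej⟩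
      have h1 := (hE j hj e hej).2
      rw [not_le, div_lt_iff₀ (by positivity)] at he2
      rw [div_le_iff₀ (by positivity)]
      have hj0 : (0 : ℝ) < 2 ^ j := by positivity
      have h2 := mul_le_mul_of_nonneg_left hN hj0.le
      have h3 := mul_le_mul_of_nonneg_right (show (w e : ℝ) ≤ 4 * (2 ^ j * n) by linarith)
        (show 0 ≤ n ^ 2 by positivity)
      linarith
    have h1 : ∑ e ∈ B.filter (fun e => ¬ (w e : ℝ) ≤ L / n ^ 2), (w e : ℝ) ≤
        ∑ j ∈ J', ((∑ e ∈ E j, w e : ℝ≥0) : ℝ) := by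
      exact_mod_cast (Finset.sum_le_sum_of_subset (f := w) hsub).trans (sum_biUnion_le _ _ _)
    refine h1.trans ?_
    rw [← Finset.sum_filter_add_sum_filter_not J' fun j : ℤ => (2 : ℝ) ^ j < L]
    have h2 : ∑ j ∈ J' with ¬ (2 : ℝ) ^ j < L, ((∑ e ∈ E j, w e : ℝ≥0) : ℝ) ≤ 0 :=
      Finset.sum_nonpos fun j hj => by
        obtain ⟨hj1, hj2⟩ := Finset.mem_filter.1 hj
        exact hsum0 j (Finset.mem_filter.1 hj1).1 (not_lt.1 hj2)
    have h3 : ∑ j ∈ J' with (2 : ℝ) ^ j < L, ((∑ e ∈ E j, w e : ℝ≥0) : ℝ) ≤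
        (J'.filter fun j : ℤ => (2 : ℝ) ^ j < L).card • A :=
      Finset.sum_le_card_nsmul _ _ _ fun j hj =>
        hsum j (Finset.mem_filter.1 (Finset.mem_filter.1 hj).1).1
    have h4 : ((J'.filter fun j : ℤ => (2 : ℝ) ^ j < L).card : ℝ) ≤ 9 * Real.log n := by
      rcases hL.eq_or_lt with h0 | h0
      · rw [Finset.filter_eq_empty_iff.2, Finset.card_empty, Nat.cast_zero]
        · linarith
        · intro j _ hj
          have : (0 : ℝ) < 2 ^ j := by positivity
          linarith
      · have hab : L / (4 * n ^ 3) ≤ L :=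
          div_le_self h0.le (by nlinarith [one_le_pow₀ (n := 3) (show 1 ≤ n by linarith)])
        refine (card_le_of_zpow_mem (by positivity) hab fun j hj => ?_).trans ?_
        · obtain ⟨hj1, hj2⟩ := Finset.mem_filter.1 hj
          exact ⟨(Finset.mem_filter.1 hj1).2, hj2.le⟩
        · have h5 : L / (L / (4 * n ^ 3)) = 4 * n ^ 3 := by field_simp
          rw [h5]
          have := logb_four_mul_pow_add_one_le hn 3
          norm_num at this
          exact this
    have h5 := mul_le_mul_of_nonneg_right h4 hA
    rw [nsmul_eq_mul] at h3
    linarith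

/-- The spanner in the case where `(200 k / ε) ^ k ≤ n`. -/
lemma IsMST.exists_spanner (hT : IsMST G w T) {ε : ℝ} {k : ℕ} (hε0 : 0 < ε)
    (hε1 : ε < 1) (hk : 1 ≤ k) (hn : (200 * k / ε) ^ k ≤ (Fintype.card V : ℝ)) :
    ∃ H, T ≤ H ∧ H ≤ G ∧
      (∀ (u v : V) (p : G.Walk u v), gdist H w u v ≤
        (1 + ε) * walkWeight w p + 4 * (200 * k / ε) ^ k * heaviestEdge w p) ∧
      (H.edgeSet.ncard : ℝ) ≤ 29 * (k * (Fintype.card V : ℝ) ^ (1 + 3 / (k : ℝ))) ∧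
      (totalWeight w H : ℝ) ≤ 18002 * Real.log (Fintype.card V) ^ 3 *
        ((Fintype.card V : ℝ) ^ (1 / (k : ℝ)) / ε) * totalWeight w T := by
  have hTc := hT.isTree.connected
  have hk1 : (1 : ℝ) ≤ k := by exact_mod_cast hk
  set n : ℝ := (Fintype.card V : ℝ) with hn'
  set M : ℝ := 200 * k / ε with hM
  set X : ℝ := n ^ (1 / (k : ℝ)) with hX
  have hMk : 200 * (k : ℝ) ≤ M := le_div_self (by positivity) hε0 hε1.le
  have hM200 : 200 ≤ M := by linarith
  have hn200 : 200 ≤ n := hM200.trans ((le_self_pow₀ (by linarith) (by omega)).trans hn)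
  have hn0 : 0 < n := by linarith
  have hXk : X ^ k = n := by
    rw [hX, ← Real.rpow_natCast, ← Real.rpow_mul hn0.le, one_div, inv_mul_cancel₀ (by positivity),
      Real.rpow_one]
  have hX0 : 0 ≤ X := by positivity
  have hMX : M ≤ X := le_of_pow_le_pow_left₀ (by omega) hX0 (hXk ▸ hn)
  have hX1 : 1 ≤ X := by linarith
  have hX3 : n ^ (1 + 3 / (k : ℝ)) = n * X ^ 3 := by
    rw [Real.rpow_add hn0, Real.rpow_one, hX, ← Real.rpow_natCast, ← Real.rpow_mul hn0.le]
    congr 2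
    push_cast
    ring
  have hkX : (k : ℝ) ≤ X := by linarith
  set l := Real.log n with hl
  have hlX : l ≤ X ^ 2 := by
    have h1 : l = k * Real.log X := by rw [hl, ← hXk, Real.log_pow]
    have h2 := Real.log_le_self hX0
    have h3 := mul_le_mul hkX h2 (Real.log_nonneg hX1) hX0
    rw [h1, pow_two]
    exact h3
  have hkl : (k : ℝ) ≤ l := by
    have h1 : Real.log (M ^ k) ≤ l := Real.log_le_log (by positivity) hn
    rw [Real.log_pow] at h1
    have h2 : 1 ≤ Real.log M := by
      rw [Real.le_log_iff_exp_le (by linarith)]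
      exact (Real.exp_one_lt_d9.le.trans (by norm_num)).trans hM200
    have h3 := mul_le_mul_of_nonneg_left h2 (show 0 ≤ (k : ℝ) by positivity)
    linarith
  have hl1 : 1 ≤ l := by linarith
  -- both counts below lose only powers of `k ≤ X` and of `l`, where `k ≤ l ≤ X ^ 2`
  have hscale := fun j : ℤ => hT.exists_scale (r := (2 : ℝ) ^ j) (M := M) (X := X) (by positivity)
    hε0 hε1 hk (by rw [hM]; exact le_of_eq (by field_simp)) hX1 hXk.ge
  choose E hE1 hE2 hE3 hE4 hE5 using hscale
  set B := (scales G w).biUnion E with hB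
  have hBG : ∀ e ∈ B, e ∈ G.edgeSet := by
    intro e he
    obtain ⟨j, -, hej⟩ := Finset.mem_biUnion.1 he
    exact (hE1 j e hej).1
  set H : SimpleGraph V := T ⊔ SimpleGraph.fromEdgeSet (B : Set (Sym2 V)) with hH
  have hmem : ∀ e, e ∈ T.edgeFinset ∪ B ↔ e ∈ H.edgeSet := by
    intro e
    rw [hH, SimpleGraph.edgeSet_sup, SimpleGraph.edgeSet_fromEdgeSet, Finset.mem_union,
      SimpleGraph.mem_edgeFinset, Set.mem_union, Set.mem_sdiff, Finset.mem_coe]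
    exact or_congr_right ⟨fun h => ⟨h, fun hd => G.not_isDiag_of_mem_edgeSet (hBG e h) hd⟩, And.left⟩
  have hTH : T ≤ H := le_sup_left
  have hHG : H ≤ G := by
    rw [← SimpleGraph.edgeSet_subset_edgeSet]
    intro e he
    rcases Finset.mem_union.1 ((hmem e).2 he) with h | h
    · exact SimpleGraph.edgeSet_mono hT.le (by simpa using h)
    · exact hBG e h
  refine ⟨H, hTH, hHG, fun u v p => ?_, ?_, ?_⟩
  · rcases (heaviestEdge w p).2.eq_or_lt with h0 | h0
    · have h0' : ((heaviestEdge w p : ℝ≥0) : ℝ) = 0 := h0.symm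
      have h1 := hT.gdist_le_card_mul_heaviestEdge p
      rw [h0', mul_zero] at h1 ⊢
      have h2 := gdist_anti (w := w) (x := u) (y := v) hTc hTH
      have : 0 ≤ (1 + ε) * (walkWeight w p : ℝ) := by positivity
      linarith
    · obtain ⟨j, hj, hj1, hj2⟩ := exists_scale_of_pos p h0
      have h1 := hE5 j H hTH hHG
        (fun e he => (hmem e).1 (Finset.mem_union_right _ (Finset.mem_biUnion.2 ⟨j, hj, he⟩))) u v p
        fun e he => le_trans (by exact_mod_cast le_heaviestEdge he) hj1
      have h2 := mul_le_mul_of_nonneg_right hj2 (show 0 ≤ M ^ k by positivity)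
      linarith
  · have h1 : H.edgeSet.ncard = (T.edgeFinset ∪ B).card := by
      rw [← Set.ncard_coe_finset]
      congr 1
      ext e
      exact (hmem e).symm
    have h2 : ((T.edgeFinset ∪ B).card : ℝ) ≤ T.edgeFinset.card + B.card := by
      exact_mod_cast Finset.card_union_le _ _
    have h3 : ((T.edgeFinset.card : ℕ) : ℝ) ≤ n := by
      have := hT.isTree.card_edgeFinset
      rw [hn']
      exact_mod_cast (show T.edgeFinset.card ≤ Fintype.card V by omega)
    have h4 := card_biUnion_scales_le (w := w) hT.isTree (J := scales G w) (E := E)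
      (A := 2 * k * (X + 1)) (N := M ^ k) (by linarith) (by positivity) hn fun j _ => hE2 j
    rw [← hB, ← hn', ← hl] at h4
    have h5 : 2 * k * (X + 1) * (n * (7 * l)) ≤ 28 * (k * (n * X ^ 3)) := by
      have a1 : (X + 1) * l ≤ (2 * X) * X ^ 2 := mul_le_mul (by linarith) hlX (by linarith) (by linarith)
      have a2 := mul_le_mul_of_nonneg_left a1 (show 0 ≤ 14 * (k * n) by positivity)
      linarith
    have h6 : n ≤ k * (n * X ^ 3) := by
      have : 1 ≤ (k : ℝ) * X ^ 3 := one_le_mul_of_one_le_of_one_le hk1 (one_le_pow₀ hX1)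
      nlinarith
    rw [h1, hX3]
    linarith
  · rw [totalWeight_eq_sum hmem]
    have h1 : ∑ e ∈ T.edgeFinset ∪ B, w e ≤ ∑ e ∈ T.edgeFinset, w e + ∑ e ∈ B, w e := by
      rw [← Finset.sum_union_inter]; exact le_self_add
    have h2 : ((∑ e ∈ T.edgeFinset ∪ B, w e : ℝ≥0) : ℝ) ≤
        totalWeight w T + ((∑ e ∈ B, w e : ℝ≥0) : ℝ) := by
      exact_mod_cast h1
    set L : ℝ := (totalWeight w T : ℝ) with hL
    have hL0 : 0 ≤ L := NNReal.coe_nonneg _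
    have h3 := sum_biUnion_scales_le (w := w) (G := G) (J := scales G w) (E := E) (L := L)
      (A := k * ((X + 4) * (2 * L * M))) (N := M ^ k) (by linarith) hL0 (by positivity) hn
      (fun j _ => hE1 j) (fun j _ => hE3 j) (fun j _ => hE4 j)
    rw [← hB, ← hn', ← hl] at h3
    have h4 : k * ((X + 4) * (2 * L * M)) = 400 * (k * k) * ((X + 4) / ε) * L := by
      rw [hM]; ring
    have h5 : X + 4 ≤ 5 * X := by linarith
    have h6 : (X + 4) / ε ≤ 5 * (X / ε) := by
      rw [← mul_div_assoc]
      exact div_le_div_of_nonneg_right h5 hε0.le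
    have h7 : (k : ℝ) * k ≤ l ^ 2 := by
      rw [pow_two]
      exact mul_le_mul hkl hkl (by positivity) (by linarith)
    have h8 : (k : ℝ) * k * ((X + 4) / ε) ≤ l ^ 2 * (5 * (X / ε)) :=
      mul_le_mul h7 h6 (by positivity) (by positivity)
    have h9 : 9 * l * (400 * (k * k) * ((X + 4) / ε) * L) ≤ 18000 * l ^ 3 * (X / ε) * L := by
      have := mul_le_mul_of_nonneg_left h8 (show 0 ≤ 3600 * l * L by positivity)
      linarith
    have h10 : 1 ≤ l ^ 3 * (X / ε) := by
      refine one_le_mul_of_one_le_of_one_le (one_le_pow₀ hl1) ?_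
      rw [le_div_iff₀ hε0]
      linarith
    have h11 := mul_le_mul_of_nonneg_right h10 hL0
    rw [h4] at h3
    linarith

end Assembly

end LightSpanner

theorem theorem1 :
    ∃ (C : ℝ) (c : ℕ), 0 < C ∧
      ∀ (V : Type*) [Fintype V] (G : SimpleGraph V) (w : Sym2 V → ℝ≥0) (ε : ℝ) (k : ℕ),
        G.Connected → 0 < ε → ε < 1 → 1 ≤ k →
        ∃ H : SimpleGraph V,
          (∀ W : V → V → ℝ≥0, LightSpanner.IsLocalMaxWeight G w W →
            LightSpanner.IsSpanner G w H (ENNReal.ofReal (1 + ε))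
              (fun u v => ENNReal.ofReal ((C * (k / ε)) ^ k) * (W u v : ℝ≥0∞))) ∧
          (H.edgeSet.ncard : ℝ) ≤ C * (k * (Fintype.card V : ℝ) ^ (1 + 3 / (k : ℝ))) ∧
          LightSpanner.lightness G w H ≤
            ENNReal.ofReal (C * Real.log (Fintype.card V) ^ c *
              ((Fintype.card V : ℝ) ^ (1 / (k : ℝ)) / ε)) := by
  classical
  -- `20000` dominates `4 * 200` in the stretch, `29` in the size and `18002` in the lightness
  refine ⟨20000, 3, by norm_num, fun V _ G w ε k hG hε0 hε1 hk => ?_⟩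
  obtain ⟨T, hT⟩ := LightSpanner.exists_isMST hG w
  have hTc := hT.isTree.connected
  have : Nonempty V := hG.nonempty
  have hk1 : (1 : ℝ) ≤ k := by exact_mod_cast hk
  have hn1 : (1 : ℝ) ≤ Fintype.card V := by exact_mod_cast Fintype.card_pos
  have hβ : 0 ≤ (20000 * (k / ε)) ^ k := by positivity
  have hpow : (1 : ℝ) ≤ (Fintype.card V : ℝ) ^ (3 / (k : ℝ)) :=
    Real.one_le_rpow hn1 (by positivity)
  rcases le_or_gt (Fintype.card V : ℝ) ((20000 * (k / ε)) ^ k) with hn | hn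
  · -- the additive error admits the minimum spanning tree itself
    refine ⟨T, LightSpanner.isSpanner_of_gdist_le hTc hT.le hε0.le hβ fun u v p => ?_, ?_, ?_⟩
    · have h1 := hT.gdist_le_card_mul_heaviestEdge p
      have h2 := mul_le_mul_of_nonneg_right hn (NNReal.coe_nonneg (LightSpanner.heaviestEdge w p))
      have : 0 ≤ (1 + ε) * (LightSpanner.walkWeight w p : ℝ) := by positivity
      linarith
    · have h1 : T.edgeSet.ncard = T.edgeFinset.card := by
        rw [← Set.ncard_coe_finset, SimpleGraph.coe_edgeFinset]
      have h2 : ((T.edgeFinset.card : ℕ) : ℝ) ≤ Fintype.card V := by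
        have := hT.isTree.card_edgeFinset
        exact_mod_cast (show T.edgeFinset.card ≤ Fintype.card V by omega)
      have h3 : (Fintype.card V : ℝ) ≤ k * (Fintype.card V : ℝ) ^ (1 + 3 / (k : ℝ)) := by
        rw [Real.rpow_add (by linarith), Real.rpow_one]
        have := one_le_mul_of_one_le_of_one_le hk1 hpow
        nlinarith
      rw [h1]
      linarith
    · rw [LightSpanner.lightness, hT.mstWeight_eq]
      rcases eq_or_lt_of_le (Nat.one_le_iff_ne_zero.2 (Fintype.card_ne_zero (α := V))) with h | h
      · -- a single vertex has no edges, and the ratio is `0 / 0`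
        have hs : Subsingleton V := Fintype.card_le_one_iff_subsingleton.1 h.ge
        have h0 : LightSpanner.totalWeight w T = 0 := by
          rw [LightSpanner.totalWeight_eq_sum (s := ∅), Finset.sum_empty]
          intro e
          induction e with
          | h a b => simp [Subsingleton.elim a b]
        simp [h0]
      · refine ENNReal.div_self_le_one.trans ?_
        rw [← ENNReal.ofReal_one]
        refine ENNReal.ofReal_le_ofReal ?_
        have h2 : (2 : ℝ) ≤ Fintype.card V := by exact_mod_cast h
        have h3 : (1 / 2 : ℝ) ≤ Real.log (Fintype.card V) :=
          le_trans (by linarith [Real.log_two_gt_d9]) (Real.log_le_log (by norm_num) h2)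
        have h4 : (1 / 2 : ℝ) ^ 3 ≤ Real.log (Fintype.card V) ^ 3 :=
          pow_le_pow_left₀ (by norm_num) h3 3
        have h5 : (1 : ℝ) ≤ (Fintype.card V : ℝ) ^ (1 / (k : ℝ)) / ε := by
          rw [le_div_iff₀ hε0]
          have := Real.one_le_rpow hn1 (show 0 ≤ 1 / (k : ℝ) by positivity)
          linarith
        refine one_le_mul_of_one_le_of_one_le ?_ h5
        norm_num at h4
        linarith
  · have hle : (200 * k / ε) ≤ 20000 * (k / ε) := by
      rw [mul_div_assoc]
      have : 0 ≤ k / ε := by positivity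
      linarith
    obtain ⟨H, hTH, hHG, h1, h2, h3⟩ := hT.exists_spanner hε0 hε1 hk
      ((pow_le_pow_left₀ (by positivity) hle k).trans hn.le)
    refine ⟨H, LightSpanner.isSpanner_of_gdist_le (hTc.mono hTH) hHG hε0.le hβ
      fun u v p => (h1 u v p).trans ?_, ?_, ?_⟩
    · have h4 : 4 * (200 * k / ε) ^ k ≤ (20000 * (k / ε)) ^ k := by
        calc 4 * (200 * k / ε) ^ k ≤ 4 ^ k * (200 * k / ε) ^ k :=
              mul_le_mul_of_nonneg_right (le_self_pow₀ (by norm_num) (by omega)) (by positivity)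
          _ = (4 * (200 * k / ε)) ^ k := (mul_pow _ _ _).symm
          _ ≤ _ := by
            refine pow_le_pow_left₀ (by positivity) ?_ k
            rw [mul_div_assoc]
            have : 0 ≤ k / ε := by positivity
            linarith
      have := mul_le_mul_of_nonneg_right h4 (NNReal.coe_nonneg (LightSpanner.heaviestEdge w p))
      linarith
    · refine h2.trans (mul_le_mul_of_nonneg_right (by norm_num) (by positivity))
    · rw [LightSpanner.lightness, hT.mstWeight_eq]
      have hlog := Real.log_nonneg hn1
      refine ENNReal.div_le_of_le_mul ?_
      rw [← ENNReal.ofReal_coe_nnreal, ← ENNReal.ofReal_coe_nnreal (p := LightSpanner.totalWeight w T),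
        ← ENNReal.ofReal_mul (by positivity)]
      refine ENNReal.ofReal_le_ofReal (h3.trans ?_)
      gcongr
      norm_num
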